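/- Let $(\mathbb B,\|\cdot\|)$ be a separable real Banach space which is $r$-smooth for some $r\in(1,2]$, that is, $\mathbb B$ has an equivalent norm $\|\cdot\|'$ such that $$\sup_{s>0}\ \sup_{\|x\|'=\|y\|'=1}\frac{\|x+sy\|'+\|x-sy\|'-2}{s^r}<\infty .$$ Let $(\xi_i)_{i\ge1}$ be an i.i.d. sequence of random variables with values in a measurable space $(S,\mathcal S)$, let $m\ge 1$ be an integer and let $h\colon S^m\to\mathbb B$ be a measurable function that is symmetric (invariant under all permutations of its $m$ arguments) and degenerate of order $d\in\{1,\dots,m\}$ with respect to $(\xi_i)_{i\ge1}$; that is, $h(\xi_1,\dots,\xi_m)$ is integrable, $$\mathbb E[h(\xi_1,\dots,\xi_m)\mid \xi_1,\dots,\xi_{d-1}]=0\ \text{ a.s.}\quad\text{and}\quad \mathbb E\big\|\mathbb E[h(\xi_1,\dots,\xi_m)\mid\xi_1,\dots,\xi_d]\big\|\ne0 .$$ For $n\ge m$ put $$U_{m,n}(h)=\sum_{1\le i_1<\dots<i_m\le n}h(\xi_{i_1},\dots,\xi_{i_m}),$$ and for $p\in(1,r]$ define the $[0,\infty]$-valued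 random variable $$H_p=\max_{0\le k\le m}\big(\mathbb E[\|h(\xi_1,\dots,\xi_m)\|^p\mid\xi_1,\dots,\xi_k]\big)^{1/p}.$$ Then for every $p\in(1,r]$, every $q>0$, every $t>0$ and every integer $N\ge 1$, $$\mathbb P\Big(\max_{m\le n\le N}\|U_{m,n}(h)\|>t\,N^{m-d+\frac dp}\Big)\le K\sum_{j=0}^m N^j\int_0^1u^{q-1}\,\mathbb P\Big(H_p>t\,N^{(\max\{d,j\}-d)\frac{p-1}{p}+\frac jp}\,u\Big)\,du ,$$ where the constant $K\in(0,\infty)$ depends only on $m$, $p$, $q$ and $\mathbb B$ (and, for $N<m$, the event on the left is understood to be empty). -/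

import Mathlib

open MeasureTheory ProbabilityTheory
open scoped ENNReal NNReal

/-- A real Banach space `B` is `r`-smooth if it has an equivalent norm `ν` such that
`(ν (x + t y) + ν (x - t y) - 2) / t ^ r` is bounded over `t > 0` and `ν x = ν y = 1`. -/
def IsRSmooth (r : ℝ) (B : Type*) [NormedAddCommGroup B] [NormedSpace ℝ B] : Prop :=
  ∃ ν : Seminorm ℝ B,
    (∃ a b : ℝ, 0 < a ∧ 0 < b ∧ ∀ x : B, a * ‖x‖ ≤ ν x ∧ ν x ≤ b * ‖x‖) ∧
    ∃ C : ℝ, ∀ t : ℝ, 0 < t → ∀ x y : B, ν x = 1 → ν y = 1 →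
      (ν (x + t • y) + ν (x - t • y) - 2) / t ^ r ≤ C

/-- The random variables `ξ 0, ξ 1, …` are independent and identically distributed. -/
structure IsIID {Ω S : Type*} [MeasurableSpace Ω] [MeasurableSpace S]
    (μ : Measure Ω) (ξ : ℕ → Ω → S) : Prop where
  measurable : ∀ i, Measurable (ξ i)
  indep : iIndepFun ξ μ
  identDistrib : ∀ i, IdentDistrib (ξ i) (ξ 0) μ μ

/-- The kernel `h` is invariant under all permutations of its `m` arguments. -/
def IsSymmetricKernel {S B : Type*} {m : ℕ} (h : (Fin m → S) → B) : Prop :=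
  ∀ (σ : Equiv.Perm (Fin m)) (x : Fin m → S), h (fun i => x (σ i)) = h x

/-- The σ-algebra generated by the first `k` variables `(ξ 0, …, ξ (k - 1))`. -/
@[reducible] def firstSigma {Ω S : Type*} [MeasurableSpace S] (ξ : ℕ → Ω → S) (k : ℕ) : MeasurableSpace Ω :=
  MeasurableSpace.comap (fun ω => fun i : Fin k => ξ i ω) MeasurableSpace.pi

/-- The random variable `h (ξ 0, …, ξ (m - 1))`. -/
def kernelAt {Ω S B : Type*} {m : ℕ} (h : (Fin m → S) → B) (ξ : ℕ → Ω → S) (ω : Ω) : B :=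
  h (fun i => ξ i ω)

/-- The (symmetric) kernel `h` is degenerate of order `d ∈ {1, …, m}`: the conditional expectation
of `h (ξ 0, …, ξ (m - 1))` given the first `d - 1` variables vanishes, and the one given the first
`d` variables does not. -/
structure IsDegenerateOfOrder {Ω S B : Type*} [MeasurableSpace Ω] [MeasurableSpace S]
    [NormedAddCommGroup B] [NormedSpace ℝ B] [CompleteSpace B] {m : ℕ}
    (μ : Measure Ω) (ξ : ℕ → Ω → S) (h : (Fin m → S) → B) (d : ℕ) : Prop where
  one_le : 1 ≤ d
  le_order : d ≤ m
  integrable : Integrable (kernelAt h ξ) μ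
  condExp_eq_zero : μ[kernelAt h ξ | firstSigma ξ (d - 1)] =ᵐ[μ] 0
  condExp_ne_zero : ∫ ω, ‖(μ[kernelAt h ξ | firstSigma ξ d]) ω‖ ∂μ ≠ 0

/-- `U_{m,n}(h)`: the sum of `h (ξ (i 0), …, ξ (i (m - 1)))` over all strictly increasing
`m`-tuples `i` of indices among the first `n` ones. -/
noncomputable def uStat {Ω S B : Type*} [AddCommMonoid B] {m : ℕ} (h : (Fin m → S) → B) (ξ : ℕ → Ω → S)
    (n : ℕ) (ω : Ω) : B :=
  ∑ i : Fin m ↪o Fin n, h (fun l => ξ (i l) ω)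

/-- `max_{m ≤ n ≤ N} ‖U_{m,n}(h)‖` (which is `0` if `N < m`). -/
noncomputable def maxUStat {Ω S B : Type*} [NormedAddCommGroup B] {m : ℕ}
    (h : (Fin m → S) → B) (ξ : ℕ → Ω → S) (N : ℕ) (ω : Ω) : ℝ≥0 :=
  (Finset.Icc m N).sup fun n => ‖uStat h ξ n ω‖₊

/-- `H_p = max_{0 ≤ k ≤ m} (E[‖h (ξ 0, …, ξ (m - 1))‖ ^ p | ξ 0, …, ξ (k - 1)]) ^ (1 / p)`, with
values in `[0, ∞]`. -/
noncomputable def maxCondMoment {Ω S B : Type*} [MeasurableSpace Ω] [MeasurableSpace S]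
    [NormedAddCommGroup B] {m : ℕ} (μ : Measure Ω) (ξ : ℕ → Ω → S) (h : (Fin m → S) → B)
    (p : ℝ) (ω : Ω) : ℝ≥0∞ :=
  (Finset.range (m + 1)).sup fun k =>
    (condLExp (firstSigma ξ k) μ (fun ω' => ‖kernelAt h ξ ω'‖ₑ ^ p) ω) ^ (1 / p)

/-! All estimates are made for `p`-th powers and in the form `tailInt`, that is `∫₀¹ u ^ (q - 1) μ(X
> s u ^ p) du`. This quantity dominates a multiple of `μ(X > s)` (`measure_le_tailInt`), and over a
product space it is an average (`tailInt_prod`), so a bound given one variable can be integrated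
over that variable.

The proof is an induction on the number of arguments (`exists_hasUTailBound`), for kernels that need
not be symmetric and that carry a parameter with law `τ`, so that norms are taken in `L^p(τ; B)`.
The role of `H_p` is played by the `p`-th moments given an arbitrary subset of the arguments
(`sumTail`).

For the induction step, group the tuples by their largest index `k` and split the kernel, in its
last argument, into mean and centred part. The mean part yields at most `N` U-statistics of a kernel
with one argument less and the same order of degeneracy; adding them without cancellation costs `N ^
p` (`HasUTailBound.drift_le`). The centred part is a martingale. Smoothness of `B` gives a two-point
inequality for `p`-th powers of an equivalent norm, hence martingale type `p`; stopping between two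
levels then gives a good-`λ` inequality, which bounds the maximum by the largest increment and the
sum of the conditional `p`-th moments (`exists_tailInt_sumPow_le`).

Both of these are again U-statistics with one argument less, with the order lowered by one. In the
conditional moments the last argument has joined the parameter, which is the reason for having a
parameter (`HasUTailBound.var_le`). Given its own variable, an increment is a U-statistic of the
kernel with frozen last argument; the union bound over `N` increments turns `N ^ j` into `N ^ (j +
1)` (`HasUTailBound.inc_le`).

Symmetry enters at the end: it replaces conditioning on a subset of the arguments by conditioning on
the first ones, which is what `H_p` controls (`partPow_trivialParam_le`). -/

set_option linter.unusedSectionVars false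

/-! ### Weighted integrals and absorption of a good-`λ` inequality. -/

/-- The weighted integral `∫₀¹ u ^ (q - 1) φ(u) du`. -/
noncomputable def weightInt (q : ℝ) (φ : ℝ → ℝ≥0∞) : ℝ≥0∞ :=
  ∫⁻ u in Set.Ioc (0 : ℝ) 1, ENNReal.ofReal (u ^ (q - 1)) * φ u

lemma weightInt_mono {q : ℝ} {φ ψ : ℝ → ℝ≥0∞} (h : ∀ u, 0 < u → u ≤ 1 → φ u ≤ ψ u) :
    weightInt q φ ≤ weightInt q ψ :=
  setLIntegral_mono' measurableSet_Ioc fun u hu => by gcongr; exact h u hu.1 hu.2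

lemma weightInt_congr {q : ℝ} {φ ψ : ℝ → ℝ≥0∞} (h : ∀ u, 0 < u → u ≤ 1 → φ u = ψ u) :
    weightInt q φ = weightInt q ψ :=
  le_antisymm (weightInt_mono fun u h0 h1 => (h u h0 h1).le)
    (weightInt_mono fun u h0 h1 => (h u h0 h1).ge)

lemma measurable_weight (q : ℝ) : Measurable fun u : ℝ => ENNReal.ofReal (u ^ (q - 1)) := by
  fun_prop

lemma weightInt_add {q : ℝ} {φ ψ : ℝ → ℝ≥0∞} (h : Measurable φ) :
    weightInt q (fun u => φ u + ψ u) = weightInt q φ + weightInt q ψ := by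
  unfold weightInt
  simp_rw [mul_add]
  exact lintegral_add_left ((measurable_weight q).mul h) _

lemma weightInt_sum {q : ℝ} {ι : Type*} (s : Finset ι) {φ : ι → ℝ → ℝ≥0∞}
    (h : ∀ i, Measurable (φ i)) :
    weightInt q (fun u => ∑ i ∈ s, φ i u) = ∑ i ∈ s, weightInt q (φ i) := by
  unfold weightInt
  simp_rw [Finset.mul_sum]
  exact lintegral_finsetSum _ fun i _ => (measurable_weight q).mul (h i)

lemma weightInt_const_mul {q : ℝ} {φ : ℝ → ℝ≥0∞} (c : ℝ≥0∞) (h : Measurable φ) :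
    weightInt q (fun u => c * φ u) = c * weightInt q φ := by
  unfold weightInt
  simp_rw [mul_left_comm _ c]
  exact lintegral_const_mul _ ((measurable_weight q).mul h)

lemma setLIntegral_Ioc_comp_mul {c : ℝ} (hc : 0 < c) (g : ℝ → ℝ≥0∞) :
    ∫⁻ u in Set.Ioc 0 c, g u = ENNReal.ofReal c * ∫⁻ u in Set.Ioc (0 : ℝ) 1, g (c * u) := by
  have e : MeasurableEmbedding fun u : ℝ => c * u :=
    (Homeomorph.mulLeft₀ c hc.ne').measurableEmbedding
  conv_lhs => rw [← Real.smul_map_volume_mul_left hc.ne']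
  rw [Measure.restrict_smul, lintegral_smul_measure, e.restrict_map, e.lintegral_map,
    abs_of_pos hc]
  congr 4
  ext u
  simp only [Set.mem_preimage, Set.mem_Ioc]
  constructor
  · rintro ⟨h1, h2⟩; exact ⟨pos_of_mul_pos_right h1 hc.le, by nlinarith⟩
  · rintro ⟨h1, h2⟩; exact ⟨by positivity, by nlinarith⟩

lemma setLIntegral_weight_Ioc {q c : ℝ} (hc : 0 < c) (φ : ℝ → ℝ≥0∞) :
    ∫⁻ u in Set.Ioc (0 : ℝ) c, ENNReal.ofReal (u ^ (q - 1)) * φ u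
      = ENNReal.ofReal (c ^ q) * weightInt q fun u => φ (c * u) := by
  rw [setLIntegral_Ioc_comp_mul hc, weightInt, ← lintegral_const_mul' _ _ ENNReal.ofReal_ne_top,
    ← lintegral_const_mul' _ _ ENNReal.ofReal_ne_top]
  refine setLIntegral_congr_fun measurableSet_Ioc fun u hu => ?_
  rw [Real.mul_rpow hc.le hu.1.le, ENNReal.ofReal_mul (by positivity), ← mul_assoc, ← mul_assoc,
    ← ENNReal.ofReal_mul hc.le, ← mul_assoc]
  congr 3
  rw [Real.rpow_sub hc, Real.rpow_one, mul_div_cancel₀ _ hc.ne']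

/-- The substitution `u ↦ c u` leaves the integral over `(0, c]`, which is part of `(0, 1]` because
`c ≤ 1`. -/
lemma weightInt_comp_mul_le {q c : ℝ} (hc : 0 < c) (hc1 : c ≤ 1) (φ : ℝ → ℝ≥0∞) :
    weightInt q (fun u => φ (c * u)) ≤ ENNReal.ofReal (c ^ (-q)) * weightInt q φ := by
  have h : ENNReal.ofReal (c ^ q) * weightInt q (fun u => φ (c * u)) ≤ weightInt q φ := by
    rw [← setLIntegral_weight_Ioc hc]
    exact lintegral_mono_set (Set.Ioc_subset_Ioc_right hc1)
  calc weightInt q (fun u => φ (c * u))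
      = ENNReal.ofReal (c ^ (-q)) * (ENNReal.ofReal (c ^ q) * weightInt q fun u => φ (c * u)) := by
        rw [← mul_assoc, ← ENNReal.ofReal_mul (by positivity), ← Real.rpow_add hc]
        simp
    _ ≤ _ := by gcongr

lemma weightInt_const {q : ℝ} (hq : 0 < q) (c : ℝ≥0∞) :
    weightInt q (fun _ => c) = ENNReal.ofReal (1 / q) * c := by
  rw [weightInt, lintegral_mul_const _ (measurable_weight q),
    ← ofReal_integral_eq_lintegral_ofReal]
  · rw [← intervalIntegral.integral_of_le zero_le_one, integral_rpow (Or.inl (by linarith))]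
    simp [hq.ne']
  · have := (intervalIntegral.intervalIntegrable_rpow' (a := 0) (b := 1) (r := q - 1)
      (by linarith))
    rwa [intervalIntegrable_iff_integrableOn_Ioc_of_le zero_le_one] at this
  · filter_upwards [ae_restrict_mem measurableSet_Ioc] with u hu
    exact Real.rpow_nonneg hu.1.le _

/-- The good-`λ` iteration in integrated form. -/
lemma weightInt_le_of_goodLambda {q b : ℝ} (hq : 0 < q) (hb : 1 < b) {ε : ℝ≥0∞}
    (hε : ENNReal.ofReal (b ^ q) * ε ≤ 1 / 2) {F M : ℝ → ℝ≥0∞} (hF : Measurable F)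
    (hF1 : ∀ u, F u ≤ 1) (h : ∀ u, 0 < u → F (b * u) ≤ ε * F u + M u) :
    weightInt q F ≤ 2 * ENNReal.ofReal (b ^ q) * weightInt q M := by
  have hb0 : 0 < b := by linarith
  -- Half of the left side will be absorbed, which requires it to be finite; this is where `F ≤ 1`
  -- and `q > 0` serve.
  have hfin : weightInt q F ≠ ∞ := by
    refine ne_top_of_le_ne_top ?_ (weightInt_mono (ψ := fun _ => 1) fun u _ _ => hF1 u)
    rw [weightInt_const hq]; simp
  have h1 : weightInt q F ≤ ENNReal.ofReal (b ^ q) * (ε * weightInt q F + weightInt q M) := by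
    -- The change of variables `u ↦ b u` maps `(0, 1 / b]` onto `(0, 1]`; afterwards the domain is
    -- enlarged back to `(0, 1]`.
    have e := setLIntegral_weight_Ioc (q := q) (c := b⁻¹) (by positivity) (fun u => F (b * u))
    have e2 : (fun u => F (b * (b⁻¹ * u))) = F := by
      ext u; rw [← mul_assoc, mul_inv_cancel₀ hb0.ne', one_mul]
    rw [e2] at e
    calc weightInt q F = ENNReal.ofReal (b ^ q) * (ENNReal.ofReal (b⁻¹ ^ q) * weightInt q F) := by
          rw [← mul_assoc, ← ENNReal.ofReal_mul (by positivity), ← Real.mul_rpow hb0.le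
            (by positivity), mul_inv_cancel₀ hb0.ne']
          simp
      _ ≤ ENNReal.ofReal (b ^ q) * weightInt q (fun u => F (b * u)) := by
          rw [← e]
          gcongr
          exact lintegral_mono_set (Set.Ioc_subset_Ioc_right (inv_le_one_of_one_le₀ hb.le))
      _ ≤ ENNReal.ofReal (b ^ q) * weightInt q (fun u => ε * F u + M u) := by
          gcongr
          exact weightInt_mono fun u hu _ => h u hu
      _ = _ := by
          rw [weightInt_add (by fun_prop), weightInt_const_mul _ hF]
  have h2 : weightInt q F ≤ weightInt q F / 2 + ENNReal.ofReal (b ^ q) * weightInt q M := by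
    refine h1.trans ?_
    rw [mul_add, ← mul_assoc, ENNReal.div_eq_inv_mul]
    gcongr
    simpa using hε
  have h3 : weightInt q F / 2 ≤ ENNReal.ofReal (b ^ q) * weightInt q M := by
    refine (ENNReal.add_le_add_iff_left (a := weightInt q F / 2) ?_).1 ?_
    · exact ENNReal.div_ne_top hfin (by simp)
    · rwa [ENNReal.add_halves]
  rw [mul_assoc]
  rwa [ENNReal.div_le_iff_le_mul (by simp) (by simp), mul_comm] at h3

/-! ### Weighted tail integrals of a nonnegative function. -/

section tail

variable {α β : Type*} [MeasurableSpace α] [MeasurableSpace β]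

/-- `∫₀¹ u ^ (q - 1) μ(X > s u ^ p) du`. -/
noncomputable def tailInt (p q : ℝ) (μ : Measure α) (X : α → ℝ≥0∞) (s : ℝ) : ℝ≥0∞ :=
  weightInt q fun u => μ {a | ENNReal.ofReal (s * u ^ p) < X a}

variable {p q s : ℝ} {μ : Measure α} {ν : Measure β}

lemma measure_lt_anti (μ : Measure α) (X : α → ℝ≥0∞) {r r' : ℝ≥0∞} (h : r ≤ r') :
    μ {a | r' < X a} ≤ μ {a | r < X a} :=
  measure_mono fun _ ha => lt_of_le_of_lt h ha

lemma measurable_measure_lt (μ : Measure α) (X : α → ℝ≥0∞) (s p : ℝ) :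
    Measurable fun u : ℝ => μ {a | ENNReal.ofReal (s * u ^ p) < X a} := by
  have h : Antitone fun r : ℝ≥0∞ => μ {a | r < X a} :=
    fun r r' hr => measure_lt_anti μ X hr
  have h2 : Measurable fun u : ℝ => ENNReal.ofReal (s * u ^ p) := by fun_prop
  exact h.measurable.comp h2

lemma tailInt_le_of_measure_le {X : α → ℝ≥0∞} {Y : β → ℝ≥0∞}
    (h : ∀ r, μ {a | r < X a} ≤ ν {b | r < Y b}) : tailInt p q μ X s ≤ tailInt p q ν Y s :=
  weightInt_mono fun _ _ _ => h _

lemma tailInt_mono_ae {X Y : α → ℝ≥0∞} (h : ∀ᵐ a ∂μ, X a ≤ Y a) :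
    tailInt p q μ X s ≤ tailInt p q μ Y s :=
  tailInt_le_of_measure_le fun r => measure_mono_ae <| by
    filter_upwards [h] with a ha hr using lt_of_lt_of_le hr ha

lemma tailInt_mono {X Y : α → ℝ≥0∞} (h : ∀ a, X a ≤ Y a) :
    tailInt p q μ X s ≤ tailInt p q μ Y s :=
  tailInt_mono_ae (Filter.Eventually.of_forall h)

lemma tailInt_antitone (X : α → ℝ≥0∞) {s' : ℝ} (h : s ≤ s') :
    tailInt p q μ X s' ≤ tailInt p q μ X s :=
  weightInt_mono fun u hu _ => measure_lt_anti _ _ (by gcongr)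

lemma tailInt_add_le {X Y : α → ℝ≥0∞} :
    tailInt p q μ (fun a => X a + Y a) s ≤ tailInt p q μ X (s / 2) + tailInt p q μ Y (s / 2) := by
  unfold tailInt
  rw [← weightInt_add (measurable_measure_lt _ _ _ _)]
  refine weightInt_mono fun u hu _ => ?_
  refine (measure_mono fun a ha => ?_).trans (measure_union_le _ _)
  by_contra hcon
  simp only [Set.mem_union, Set.mem_ofPred_eq, not_or, not_lt] at hcon ha
  refine absurd ha (not_lt.2 ?_)
  rcases le_or_gt 0 s with hs | hs
  · calc X a + Y a ≤ ENNReal.ofReal (s / 2 * u ^ p) + ENNReal.ofReal (s / 2 * u ^ p) :=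
        add_le_add hcon.1 hcon.2
      _ = ENNReal.ofReal (s * u ^ p) := by
        rw [← ENNReal.ofReal_add (by positivity) (by positivity)]; congr 1; ring
  · have h0 : s / 2 * u ^ p ≤ 0 :=
      mul_nonpos_of_nonpos_of_nonneg (by linarith) (by positivity)
    rw [ENNReal.ofReal_of_nonpos h0] at hcon
    exact (add_le_add hcon.1 hcon.2).trans (by simp)

lemma tailInt_sup_le {ι : Type*} (F : Finset ι) (X : ι → α → ℝ≥0∞) :
    tailInt p q μ (fun a => F.sup fun i => X i a) s ≤ ∑ i ∈ F, tailInt p q μ (X i) s := by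
  unfold tailInt
  rw [← weightInt_sum _ fun i => measurable_measure_lt _ _ _ _]
  refine weightInt_mono fun u hu _ => ?_
  refine (measure_mono fun a ha => ?_).trans (measure_biUnion_finset_le F _)
  simpa [Finset.lt_sup_iff] using ha

/-- Since `c * u ^ p = (c ^ (1 / p) * u) ^ p`, rescaling `u` absorbs `c`. Constant factors in a
threshold thus cost only constant factors in the bound. -/
lemma tailInt_mul_le (hp : 0 < p) {c : ℝ} (hc : 0 < c) (hc1 : c ≤ 1) (X : α → ℝ≥0∞) :
    tailInt p q μ X (c * s) ≤ ENNReal.ofReal (c ^ (-(q / p))) * tailInt p q μ X s := by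
  have h := weightInt_comp_mul_le (q := q) (c := c ^ (1 / p)) (by positivity)
    (Real.rpow_le_one hc.le hc1 (by positivity))
    (fun u => μ {a | ENNReal.ofReal (s * u ^ p) < X a})
  rw [← Real.rpow_mul hc.le, show 1 / p * -q = -(q / p) by ring] at h
  refine le_trans (weightInt_mono fun u hu _ => ?_) h
  rw [Real.mul_rpow (by positivity) hu.le, ← Real.rpow_mul hc.le, one_div_mul_cancel hp.ne',
    Real.rpow_one, ← mul_assoc, mul_comm s c]

lemma tailInt_const_mul (X : α → ℝ≥0∞) {c : ℝ} (hc : 0 < c) :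
    tailInt p q μ (fun a => ENNReal.ofReal c * X a) (c * s) = tailInt p q μ X s := by
  refine weightInt_congr fun u hu _ => ?_
  congr 1
  ext a
  simp only [Set.mem_ofPred_eq]
  rw [mul_assoc, ENNReal.ofReal_mul hc.le,
    ENNReal.mul_lt_mul_iff_right (by simpa using hc) ENNReal.ofReal_ne_top]

/-- The weight has mass `1 / q` on `(0, 1]`, and lowering the level from `s` to `s * u ^ p` only
enlarges the event. -/
lemma measure_le_tailInt (hp : 0 < p) (hq : 0 < q) (hs : 0 ≤ s) (X : α → ℝ≥0∞) :
    μ {a | ENNReal.ofReal s < X a} ≤ ENNReal.ofReal q * tailInt p q μ X s := by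
  calc μ {a | ENNReal.ofReal s < X a}
      = ENNReal.ofReal q * weightInt q (fun _ => μ {a | ENNReal.ofReal s < X a}) := by
        rw [weightInt_const hq, ← mul_assoc, ← ENNReal.ofReal_mul hq.le, mul_one_div_cancel hq.ne']
        simp
    _ ≤ _ := by
        gcongr
        refine weightInt_mono fun u hu hu1 => measure_lt_anti _ _ ?_
        gcongr
        exact mul_le_of_le_one_right hs (Real.rpow_le_one hu.le hu1 hp.le)

lemma tailInt_measurePreserving {f : α → β} (hf : MeasurePreserving f μ ν) {X : β → ℝ≥0∞}
    (hX : Measurable X) : tailInt p q μ (fun a => X (f a)) s = tailInt p q ν X s := by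
  refine weightInt_congr fun u _ _ => ?_
  exact hf.measure_preimage (measurableSet_lt measurable_const hX).nullMeasurableSet

lemma tailInt_prod [SFinite μ] [SFinite ν] {X : α × β → ℝ≥0∞} (hX : Measurable X) :
    tailInt p q (μ.prod ν) X s = ∫⁻ b, tailInt p q μ (fun a => X (a, b)) s ∂ν := by
  have hS : MeasurableSet {w : (β × ℝ) × α | ENNReal.ofReal (s * w.1.2 ^ p) < X (w.2, w.1.1)} :=
    measurableSet_lt (by fun_prop) (by fun_prop)
  have hm : Measurable fun z : β × ℝ => μ {a | ENNReal.ofReal (s * z.2 ^ p) < X (a, z.1)} :=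
    measurable_measure_prodMk_left hS
  have hw : Measurable fun z : β × ℝ => ENNReal.ofReal (z.2 ^ (q - 1)) := by fun_prop
  unfold tailInt weightInt
  rw [lintegral_lintegral_swap (hw.mul hm).aemeasurable]
  refine setLIntegral_congr_fun measurableSet_Ioc fun u hu => ?_
  simp only
  rw [lintegral_const_mul' _ _ ENNReal.ofReal_ne_top,
    Measure.prod_apply_symm (measurableSet_lt measurable_const hX)]
  rfl

end tail

/-! ### Smoothness of the norm and moments of sums with a centred term. -/

lemma rpow_le_quadratic {p A : ℝ} (hp : 1 < p) (hp2 : p ≤ 2) (hA : 0 ≤ A) :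
    A ^ p ≤ 1 + p * (A - 1) + (A - 1) ^ 2 := by
  -- Bernoulli's inequality for the exponent `p - 1 ∈ (0, 1]`; multiplied by `A` it gives the
  -- quadratic bound.
  have h := rpow_one_add_le_one_add_mul_self (s := A - 1) (p := p - 1) (by linarith)
    (by linarith) (by linarith)
  rw [add_sub_cancel] at h
  have h2 : A ^ p = A * A ^ (p - 1) := by
    rcases hA.eq_or_lt with rfl | hA
    · rw [Real.zero_rpow (by linarith), zero_mul]
    · rw [Real.rpow_sub hA, Real.rpow_one, mul_div_cancel₀ _ hA.ne']
  rw [h2]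
  nlinarith [mul_le_mul_of_nonneg_left h hA, sq_nonneg (A - 1)]

/-- For `s < 1` the quadratic bound leaves `p * (A + D - 2)`, at most `2 * C₀ * s ^ p`, and two
squares, each at most `s ^ 2 ≤ s ^ p`. For `s ≥ 1` both numbers are at most `2 * s`, and each power
is at most `4 * s ^ p`. The constant `10` leaves room for both cases. -/
lemma rpow_add_rpow_le_of_sum_le {p r s A D C₀ : ℝ} (hp : 1 < p) (hpr : p ≤ r) (hr : r ≤ 2)
    (hC : 0 ≤ C₀) (hs : 0 < s) (hA : 0 ≤ A) (hD : 0 ≤ D) (hA1 : |A - 1| ≤ s) (hD1 : |D - 1| ≤ s)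
    (h : A + D ≤ 2 + C₀ * s ^ r) : A ^ p + D ^ p ≤ 2 + (10 + 2 * C₀) * s ^ p := by
  have hsp : 0 < s ^ p := Real.rpow_pos_of_pos hs p
  rcases le_or_gt 1 s with h1 | h1
  · have key : ∀ x : ℝ, 0 ≤ x → |x - 1| ≤ s → x ^ p ≤ 4 * s ^ p := by
      intro x hx hx1
      have : x ≤ 2 * s := by linarith [(abs_le.1 hx1).2]
      calc x ^ p ≤ (2 * s) ^ p := Real.rpow_le_rpow hx this (by linarith)
        _ = 2 ^ p * s ^ p := Real.mul_rpow (by norm_num) hs.le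
        _ ≤ 2 ^ (2 : ℝ) * s ^ p := by gcongr <;> linarith
        _ = 4 * s ^ p := by norm_num
    nlinarith [key A hA hA1, key D hD hD1, mul_nonneg hC hsp.le]
  · have e1 : s ^ r ≤ s ^ p := Real.rpow_le_rpow_of_exponent_ge hs h1.le hpr
    have e2 : s ^ 2 ≤ s ^ p := by
      rw [← Real.rpow_two]
      exact Real.rpow_le_rpow_of_exponent_ge hs h1.le (by linarith)
    have a1 := rpow_le_quadratic hp (hpr.trans hr) hA
    have d1 := rpow_le_quadratic hp (hpr.trans hr) hD
    have a2 : (A - 1) ^ 2 ≤ s ^ 2 := sq_le_sq' (by linarith [(abs_le.1 hA1).1]) (abs_le.1 hA1).2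
    have d2 : (D - 1) ^ 2 ≤ s ^ 2 := sq_le_sq' (by linarith [(abs_le.1 hD1).1]) (abs_le.1 hD1).2
    have h3 : p * (A + D - 2) ≤ 2 * (C₀ * s ^ p) := by
      have : A + D - 2 ≤ C₀ * s ^ p := by nlinarith
      have h0 : 0 ≤ C₀ * s ^ p := by positivity
      nlinarith
    nlinarith

section smooth

variable {B : Type*} [NormedAddCommGroup B] [NormedSpace ℝ B]

/-- An equivalent norm whose `p`-th power satisfies a two-point smoothness inequality. -/
structure IsPowerSmooth (p C : ℝ) (ν : Seminorm ℝ B) : Prop where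
  equiv : ∃ a b : ℝ, 0 < a ∧ 0 < b ∧ ∀ x : B, a * ‖x‖ ≤ ν x ∧ ν x ≤ b * ‖x‖
  two_point : ∀ x y : B, ν (x + y) ^ p + ν (x - y) ^ p ≤ 2 * ν x ^ p + C * ν y ^ p

/-- By homogeneity it suffices to treat `ν x = 1`. There the smoothness bound, with step `ν y`,
controls the sum of the two norms, and each of them differs from `1` by at most `ν y`. -/
lemma IsRSmooth.exists_isPowerSmooth {p r : ℝ} (hp : 1 < p) (hpr : p ≤ r) (hr : r ≤ 2)
    (h : IsRSmooth r B) : ∃ ν : Seminorm ℝ B, ∃ C : ℝ, 0 < C ∧ IsPowerSmooth p C ν := by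
  obtain ⟨ν, ⟨a, b, ha, hb, hab⟩, C, hC⟩ := h
  refine ⟨ν, 10 + 2 * max C 0, by positivity, ⟨a, b, ha, hb, hab⟩, ?_⟩
  have hzero : ∀ x, ν x = 0 → x = 0 := fun x hx => by
    have := (hab x).1
    rw [hx] at this
    exact norm_le_zero_iff.1 (by nlinarith [norm_nonneg x])
  have hp0 : p ≠ 0 := by linarith
  have unit : ∀ x y : B, ν x = 1 → ν (x + y) ^ p + ν (x - y) ^ p
      ≤ 2 + (10 + 2 * max C 0) * ν y ^ p := by
    intro x y hx
    rcases (apply_nonneg ν y).eq_or_lt with hy | hy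
    · rw [hzero y hy.symm]; simp [hx, hp0]; norm_num
    · have hC' := hC (ν y) hy x ((ν y)⁻¹ • y) hx (by
        rw [map_smul_eq_mul, Real.norm_of_nonneg (by positivity), inv_mul_cancel₀ hy.ne'])
      rw [smul_inv_smul₀ hy.ne', div_le_iff₀ (by positivity)] at hC'
      have t1 : ∀ z, |ν (x + z) - 1| ≤ ν z := fun z => by
        have e1 := map_add_le_add ν x z
        have e2 := map_add_le_add ν (x + z) (-z)
        rw [add_neg_cancel_right, map_neg_eq_map] at e2
        rw [abs_le]; constructor <;> linarith
      refine rpow_add_rpow_le_of_sum_le hp hpr hr (le_max_right _ _) hy (apply_nonneg _ _)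
        (apply_nonneg _ _) (t1 y) ?_ ?_
      · have := t1 (-y); rwa [map_neg_eq_map, ← sub_eq_add_neg] at this
      · have : C * ν y ^ r ≤ max C 0 * ν y ^ r := by gcongr; exact le_max_left _ _
        linarith
  intro x y
  rcases (apply_nonneg ν x).eq_or_lt with hx | hx
  · rw [hzero x hx.symm]
    simp only [zero_add, zero_sub, map_neg_eq_map, map_zero, Real.zero_rpow hp0]
    have : 0 ≤ ν y ^ p := Real.rpow_nonneg (apply_nonneg _ _) _
    nlinarith [mul_nonneg (le_max_right C 0) this]
  · have hu := unit ((ν x)⁻¹ • x) ((ν x)⁻¹ • y) (by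
      rw [map_smul_eq_mul, Real.norm_of_nonneg (by positivity), inv_mul_cancel₀ hx.ne'])
    rw [← smul_add, ← smul_sub] at hu
    simp only [map_smul_eq_mul, Real.norm_of_nonneg (inv_nonneg.2 hx.le)] at hu
    rw [Real.mul_rpow (by positivity) (apply_nonneg _ _),
      Real.mul_rpow (by positivity) (apply_nonneg _ _),
      Real.mul_rpow (by positivity) (apply_nonneg _ _), Real.inv_rpow hx.le] at hu
    have hxp : 0 < ν x ^ p := Real.rpow_pos_of_pos hx p
    have := mul_le_mul_of_nonneg_left hu hxp.le
    have c : ∀ z, ν x ^ p * ((ν x ^ p)⁻¹ * z) = z := fun z => by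
      rw [← mul_assoc, mul_inv_cancel₀ hxp.ne', one_mul]
    rw [mul_add, mul_add, c, c, mul_left_comm, c] at this
    linarith

namespace IsPowerSmooth

variable {p C : ℝ} {ν : Seminorm ℝ B}

lemma continuous (hν : IsPowerSmooth p C ν) : Continuous ν := by
  obtain ⟨a, b, _, hb, hab⟩ := hν.equiv
  refine Seminorm.continuous_of_continuousAt_zero ?_
  rw [ContinuousAt, map_zero]
  refine squeeze_zero (fun x => apply_nonneg _ _) (fun x => (hab x).2) ?_
  have : Continuous fun x : B => b * ‖x‖ := by fun_prop
  simpa using this.tendsto 0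

/-- The `p`-th power of the equivalent norm, with values in `[0, ∞]`. -/
noncomputable def _root_.Seminorm.epow (ν : Seminorm ℝ B) (p : ℝ) (x : B) : ℝ≥0∞ :=
  ENNReal.ofReal (ν x ^ p)

lemma continuous_epow (hν : IsPowerSmooth p C ν) (hp : 0 ≤ p) : Continuous (ν.epow p) :=
  ENNReal.continuous_ofReal.comp (hν.continuous.rpow_const fun _ => Or.inr hp)

lemma convexOn_rpow (hp : 1 ≤ p) : ConvexOn ℝ Set.univ fun x => ν x ^ p := by
  refine ⟨convex_univ, fun x _ y _ s t hs ht hst => ?_⟩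
  have h1 := ν.convexOn.2 (Set.mem_univ x) (Set.mem_univ y) hs ht hst
  have h2 := (_root_.convexOn_rpow hp).2 (apply_nonneg ν x) (apply_nonneg ν y) hs ht hst
  exact (Real.rpow_le_rpow (apply_nonneg _ _) h1 (by linarith)).trans h2

variable [CompleteSpace B] {S : Type*} [MeasurableSpace S]
  {P : Measure S} [IsProbabilityMeasure P]

lemma epow_integral_le (hν : IsPowerSmooth p C ν) (hp : 1 ≤ p) {Z : S → B}
    (hZ : Integrable Z P) : ν.epow p (∫ s, Z s ∂P) ≤ ∫⁻ s, ν.epow p (Z s) ∂P := by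
  by_cases hfin : ∫⁻ s, ν.epow p (Z s) ∂P = ∞
  · rw [hfin]; exact le_top
  have hc : Continuous fun x => ν x ^ p :=
    hν.continuous.rpow_const fun _ => Or.inr (by linarith)
  have hnn : ∀ x, 0 ≤ ν x ^ p := fun x => Real.rpow_nonneg (apply_nonneg _ _) _
  have hint : Integrable (fun s => ν (Z s) ^ p) P := by
    refine ⟨hc.comp_aestronglyMeasurable hZ.1, ?_⟩
    rw [hasFiniteIntegral_iff_ofReal (Filter.Eventually.of_forall fun s => hnn _)]
    exact lt_top_iff_ne_top.2 hfin
  have h := (convexOn_rpow (ν := ν) hp).map_integral_le hc.continuousOn isClosed_univ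
    (Filter.Eventually.of_forall fun _ => Set.mem_univ _) hZ hint
  unfold Seminorm.epow
  rw [← ofReal_integral_eq_lintegral_ofReal hint (Filter.Eventually.of_forall fun s => hnn _)]
  exact ENNReal.ofReal_le_ofReal h

/-- Adding a centred random vector increases the `p`-th moment at most by a multiple of its own. -/
lemma lintegral_epow_add_le (hν : IsPowerSmooth p C ν) (hp : 1 ≤ p) (hC : 0 ≤ C) (x : B) {Z : S → B}
    (hZ : Integrable Z P) (hZ0 : ∫ s, Z s ∂P = 0) :
    ∫⁻ s, ν.epow p (x + Z s) ∂P ≤ ν.epow p x + ENNReal.ofReal C * ∫⁻ s, ν.epow p (Z s) ∂P := by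
  have hnn : ∀ x, 0 ≤ ν x ^ p := fun x => Real.rpow_nonneg (apply_nonneg _ _) _
  have hm := hν.continuous_epow (by linarith : 0 ≤ p)
  have hmZ : AEMeasurable (fun s => ν.epow p (Z s)) P :=
    (hm.comp_aestronglyMeasurable hZ.1).aemeasurable
  have hmA : AEMeasurable (fun s => ν.epow p (x + Z s)) P :=
    (hm.comp_aestronglyMeasurable (aestronglyMeasurable_const.add hZ.1)).aemeasurable
  -- Jensen's inequality, since `x` is the mean of `x - Z`. Subtracting this from the averaged
  -- two-point inequality removes one copy of `ν x ^ p`; only this finite number is cancelled, so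
  -- the moment of `Z` may be infinite.
  have h1 : ν.epow p x ≤ ∫⁻ s, ν.epow p (x - Z s) ∂P := by
    have := hν.epow_integral_le hp ((integrable_const x).sub hZ)
    simpa [integral_sub (integrable_const x) hZ, hZ0] using this
  have h2 : ∫⁻ s, ν.epow p (x + Z s) ∂P + ∫⁻ s, ν.epow p (x - Z s) ∂P
      ≤ 2 * ν.epow p x + ENNReal.ofReal C * ∫⁻ s, ν.epow p (Z s) ∂P := by
    rw [← lintegral_add_left' hmA, ← lintegral_const_mul' _ _ ENNReal.ofReal_ne_top]
    calc _ ≤ ∫⁻ s, (2 * ν.epow p x + ENNReal.ofReal C * ν.epow p (Z s)) ∂P := by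
          refine lintegral_mono fun s => ?_
          unfold Seminorm.epow
          rw [← ENNReal.ofReal_add (hnn _) (hnn _), ← ENNReal.ofReal_mul hC,
            show (2 : ℝ≥0∞) = ENNReal.ofReal 2 by simp, ← ENNReal.ofReal_mul (by norm_num),
            ← ENNReal.ofReal_add (mul_nonneg (by norm_num) (hnn _)) (mul_nonneg hC (hnn _))]
          exact ENNReal.ofReal_le_ofReal (hν.two_point x (Z s))
      _ = _ := by rw [lintegral_add_left measurable_const]; simp
  refine (ENNReal.add_le_add_iff_right (a := ν.epow p x) ENNReal.ofReal_ne_top).1 ?_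
  calc _ ≤ _ := add_le_add_right h1 _
    _ ≤ _ := h2
    _ = _ := by ring

end IsPowerSmooth

end smooth

/-! ### I.i.d. families: gluing, updating and resampling coordinates. -/

section glue

variable {S ι κ ι' : Type*} [MeasurableSpace S] (P : Measure S) [IsProbabilityMeasure P]

/-- The law of an i.i.d. family indexed by `ι` with common law `P`. -/
noncomputable abbrev iidLaw (ι : Type*) (P : Measure S) : Measure (ι → S) :=
  Measure.infinitePi fun _ : ι => P

lemma measurePreserving_sumElim :
    MeasurePreserving (fun z : (ι → S) × (κ → S) => (Sum.elim z.1 z.2 : ι ⊕ κ → S))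
      ((iidLaw ι P).prod (iidLaw κ P)) (iidLaw (ι ⊕ κ) P) := by
  have hm : Measurable fun z : (ι → S) × (κ → S) => (Sum.elim z.1 z.2 : ι ⊕ κ → S) := by
    refine measurable_pi_iff.2 fun i => ?_
    rcases i with i | i
    · exact (measurable_pi_apply i).comp measurable_fst
    · exact (measurable_pi_apply i).comp measurable_snd
  refine ⟨hm, Measure.eq_infinitePi _ fun s t ht => ?_⟩
  have hs : (fun z : (ι → S) × (κ → S) => (Sum.elim z.1 z.2 : ι ⊕ κ → S)) ⁻¹' Set.pi s t
      = (Set.pi s.toLeft fun i => t (Sum.inl i)) ×ˢ (Set.pi s.toRight fun i => t (Sum.inr i)) := by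
    ext z
    simp [Set.mem_pi, Sum.forall]
  rw [Measure.map_apply hm (MeasurableSet.pi s.countable_toSet fun i _ => ht i), hs,
    Measure.prod_prod, Measure.infinitePi_pi _ fun i _ => ht _, Measure.infinitePi_pi _ fun i _ => ht _]
  conv_rhs => rw [← Finset.toLeft_disjSum_toRight (u := s), Finset.prod_disjSum]

lemma measurePreserving_comp_injective {f : ι' → ι} (hf : f.Injective) :
    MeasurePreserving (fun (x : ι → S) i => x (f i)) (iidLaw ι P) (iidLaw ι' P) :=
  ⟨by fun_prop, Measure.map_infinitePi_infinitePi_of_inj hf⟩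

/-- Reading distinct coordinates off two independent families gives an i.i.d. family. Updating a
coordinate, mixing two families and appending an argument are all instances. -/
lemma measurePreserving_glue {f : ι' → ι ⊕ κ} (hf : f.Injective) :
    MeasurePreserving (fun (z : (ι → S) × (κ → S)) i => Sum.elim z.1 z.2 (f i))
      ((iidLaw ι P).prod (iidLaw κ P)) (iidLaw ι' P) :=
  (measurePreserving_comp_injective P hf).comp (measurePreserving_sumElim P)

lemma measurePreserving_const_unit :
    MeasurePreserving (fun (s : S) (_ : Unit) => s) P (iidLaw Unit P) := by
  have h : MeasurePreserving (MeasurableEquiv.funUnique Unit S) (iidLaw Unit P) P :=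
    measurePreserving_eval_infinitePi (fun _ : Unit => P) ()
  exact h.symm

lemma measurePreserving_glue_unit {f : ι' → ι ⊕ Unit} (hf : f.Injective) :
    MeasurePreserving (fun (z : (ι → S) × S) i => Sum.elim z.1 (fun _ => z.2) (f i))
      ((iidLaw ι P).prod P) (iidLaw ι' P) :=
  (measurePreserving_glue P hf).comp ((MeasurePreserving.id _).prod (measurePreserving_const_unit P))

lemma measurePreserving_update [DecidableEq ι] (k : ι) :
    MeasurePreserving (fun z : (ι → S) × S => Function.update z.1 k z.2)
      ((iidLaw ι P).prod P) (iidLaw ι P) := by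
  have hf : Function.Injective fun i => if i = k then (Sum.inr () : ι ⊕ Unit) else Sum.inl i := by
    intro i j h
    by_cases hi : i = k <;> by_cases hj : j = k <;> simp_all
  convert measurePreserving_glue_unit P hf using 2 with z
  ext i
  by_cases hi : i = k
  · subst hi; simp
  · simp [hi]

lemma measurePreserving_piecewise [DecidableEq ι] (J : Finset ι) :
    MeasurePreserving (fun z : (ι → S) × (ι → S) => J.piecewise z.1 z.2)
      ((iidLaw ι P).prod (iidLaw ι P)) (iidLaw ι P) := by
  have hf : Function.Injective fun i => if i ∈ J then (Sum.inl i : ι ⊕ ι) else Sum.inr i := by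
    intro i j h
    by_cases hi : i ∈ J <;> by_cases hj : j ∈ J <;> simp_all
  convert measurePreserving_glue P hf using 2 with z
  ext i
  by_cases hi : i ∈ J <;> simp [hi]

/-- Appending a last argument, without dependent types. -/
def snocArg {m : ℕ} (x : Fin m → S) (s : S) : Fin (m + 1) → S := Fin.snoc (α := fun _ => S) x s

lemma measurePreserving_snocArg (m : ℕ) :
    MeasurePreserving (fun z : (Fin m → S) × S => snocArg z.1 z.2)
      ((iidLaw (Fin m) P).prod P) (iidLaw (Fin (m + 1)) P) := by
  have hf : Function.Injective
      (Fin.lastCases (Sum.inr ()) (fun i => Sum.inl i) : Fin (m + 1) → Fin m ⊕ Unit) := by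
    intro i j
    refine Fin.lastCases ?_ (fun i => ?_) i <;> refine Fin.lastCases ?_ (fun j => ?_) j <;> simp
  convert measurePreserving_glue_unit P hf using 2 with z
  ext i
  refine Fin.lastCases ?_ (fun i => ?_) i <;> simp [snocArg]

variable {T : Type*} [MeasurableSpace T] (τ : Measure T) [SFinite τ]

/-- An independent copy in coordinate `k` does not change the law. The inner integral acts as the
conditional expectation given all the other coordinates and the parameter. -/
lemma lintegral_resample [DecidableEq ι] (k : ι) {f : (ι → S) × T → ℝ≥0∞} (hf : Measurable f) :
    ∫⁻ z, ∫⁻ y, f (Function.update z.1 k y, z.2) ∂P ∂((iidLaw ι P).prod τ)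
      = ∫⁻ z, f z ∂((iidLaw ι P).prod τ) := by
  have hu : Measurable fun w : ((ι → S) × T) × S => f (Function.update w.1.1 k w.2, w.1.2) := by
    refine hf.comp (Measurable.prodMk ?_ (by fun_prop))
    exact (measurePreserving_update P k).measurable.comp
      (Measurable.prodMk (by fun_prop) (by fun_prop))
  rw [lintegral_prod _ hu.lintegral_prod_right'.aemeasurable, lintegral_prod _ hf.aemeasurable,
    ← (measurePreserving_update P k).lintegral_comp hf.lintegral_prod_right', lintegral_prod]
  · refine lintegral_congr fun x => ?_
    have hx : Measurable fun w : T × S => (((x, w.1), w.2) : ((ι → S) × T) × S) := by fun_prop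
    exact lintegral_lintegral_swap (f := fun t y => f (Function.update x k y, t))
      (hu.comp hx).aemeasurable
  · exact (hf.lintegral_prod_right'.comp (measurePreserving_update P k).measurable).aemeasurable

end glue

/-! ### Martingale differences and martingale type. -/

/-- The functions `E k`, of an i.i.d. sequence and of a parameter, depend on the first `k + 1`
coordinates of the sequence and are centred in the coordinate `k`. -/
structure IsMartDiff {B S T : Type*} [NormedAddCommGroup B] [NormedSpace ℝ B]
    [MeasurableSpace S] [MeasurableSpace T] (P : Measure S) [IsProbabilityMeasure P]
    (τ : Measure T) (E : ℕ → (ℕ → S) × T → B) : Prop where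
  stronglyMeasurable : ∀ k, StronglyMeasurable (E k)
  adapted : ∀ k l, k < l → ∀ x y t, E k (Function.update x l y, t) = E k (x, t)
  integrable : ∀ k, ∀ᵐ z ∂((iidLaw ℕ P).prod τ),
    Integrable (fun y => E k (Function.update z.1 k y, z.2)) P
  integral_eq_zero : ∀ k, ∀ᵐ z ∂((iidLaw ℕ P).prod τ),
    ∫ y, E k (Function.update z.1 k y, z.2) ∂P = 0

namespace IsPowerSmooth

variable {B : Type*} [NormedAddCommGroup B] [NormedSpace ℝ B] [CompleteSpace B]
  {p C : ℝ} {ν : Seminorm ℝ B}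
  {S T : Type*} [MeasurableSpace S] {P : Measure S} [IsProbabilityMeasure P]
  [MeasurableSpace T] {τ : Measure T} [SFinite τ]

/-- The `p`-th moment inequality for martingales adapted to an i.i.d. sequence. -/
lemma lintegral_epow_sum_le (hν : IsPowerSmooth p C ν) (hp : 1 ≤ p) (hC : 0 ≤ C)
    {E : ℕ → (ℕ → S) × T → B} (hE : IsMartDiff P τ E) (n : ℕ) :
    ∫⁻ z, ν.epow p (∑ k ∈ Finset.range n, E k z) ∂((iidLaw ℕ P).prod τ)
      ≤ ENNReal.ofReal C * ∑ k ∈ Finset.range n,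
        ∫⁻ z, ν.epow p (E k z) ∂((iidLaw ℕ P).prod τ) := by
  have hm := hν.continuous_epow (by linarith : 0 ≤ p)
  have hY : ∀ n, StronglyMeasurable fun z => ∑ k ∈ Finset.range n, E k z := fun n =>
    Finset.stronglyMeasurable_fun_sum _ fun k _ => hE.1 k
  induction n with
  | zero =>
    have : p ≠ 0 := by linarith
    simp [Seminorm.epow, this]
  | succ n ih =>
    have h1 : ∫⁻ z, ν.epow p (∑ k ∈ Finset.range (n + 1), E k z) ∂((iidLaw ℕ P).prod τ)
        ≤ ∫⁻ z, (ν.epow p (∑ k ∈ Finset.range n, E k z) + ENNReal.ofReal C *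
          ∫⁻ y, ν.epow p (E n (Function.update z.1 n y, z.2)) ∂P) ∂((iidLaw ℕ P).prod τ) := by
      -- Once coordinate `n` is resampled, the earlier increments are constant in it and `E n` is
      -- centred in it, so the inequality for one centred term applies.
      rw [← lintegral_resample P τ n (hm.comp_stronglyMeasurable (hY (n + 1))).measurable]
      refine lintegral_mono_ae ?_
      filter_upwards [hE.3 n, hE.4 n] with z hz1 hz2
      refine le_trans (le_of_eq ?_) (hν.lintegral_epow_add_le hp hC _ hz1 hz2)
      refine lintegral_congr fun y => ?_
      rw [Finset.sum_range_succ]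
      congr 2
      exact Finset.sum_congr rfl fun k hk => hE.2 k n (Finset.mem_range.1 hk) _ _ _
    refine h1.trans ?_
    rw [lintegral_add_left (hm.comp_stronglyMeasurable (hY n)).measurable,
      lintegral_const_mul' _ _ ENNReal.ofReal_ne_top,
      lintegral_resample P τ n (hm.comp_stronglyMeasurable (hE.1 n)).measurable,
      Finset.sum_range_succ, mul_add]
    gcongr

end IsPowerSmooth

/-- The space `B` has martingale type `p` with constant `C`, for martingales adapted to i.i.d.
sequences and depending on an additional parameter. -/
def HasMartingaleType.{u, v} (p : ℝ) (C : ℝ≥0∞) (B : Type v) [NormedAddCommGroup B]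
    [NormedSpace ℝ B] : Prop :=
  ∀ (S T : Type u) [MeasurableSpace S] [MeasurableSpace T] (P : Measure S) [IsProbabilityMeasure P]
    (τ : Measure T) [IsProbabilityMeasure τ] (E : ℕ → (ℕ → S) × T → B),
    IsMartDiff P τ E →
    ∀ n, ∫⁻ z, ‖∑ k ∈ Finset.range n, E k z‖ₑ ^ p ∂((iidLaw ℕ P).prod τ)
      ≤ C * ∑ k ∈ Finset.range n, ∫⁻ z, ‖E k z‖ₑ ^ p ∂((iidLaw ℕ P).prod τ)

lemma IsPowerSmooth.exists_hasMartingaleType.{u, v} {B : Type v} [NormedAddCommGroup B]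
    [NormedSpace ℝ B] [CompleteSpace B] {p C : ℝ} {ν : Seminorm ℝ B} (hν : IsPowerSmooth p C ν)
    (hp : 1 ≤ p) (hC : 0 ≤ C) : ∃ C' : ℝ≥0∞, C' ≠ ∞ ∧ HasMartingaleType.{u, v} p C' B := by
  have hp0 : 0 ≤ p := by linarith
  obtain ⟨a, b, ha, hb, hab⟩ := hν.equiv
  have h1 : ∀ x : B, ‖x‖ₑ ^ p ≤ ENNReal.ofReal (a⁻¹ ^ p) * ν.epow p x := fun x => by
    rw [Seminorm.epow, ← ENNReal.ofReal_mul (by positivity),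
      ← Real.mul_rpow (by positivity) (apply_nonneg _ _), ← ofReal_norm,
      ENNReal.ofReal_rpow_of_nonneg (norm_nonneg _) hp0]
    refine ENNReal.ofReal_le_ofReal (Real.rpow_le_rpow (norm_nonneg _) ?_ hp0)
    rw [inv_mul_eq_div, le_div_iff₀ ha, mul_comm]
    exact (hab x).1
  have h2 : ∀ x : B, ν.epow p x ≤ ENNReal.ofReal (b ^ p) * ‖x‖ₑ ^ p := fun x => by
    rw [Seminorm.epow, ← ofReal_norm,
      ENNReal.ofReal_rpow_of_nonneg (norm_nonneg _) hp0, ← ENNReal.ofReal_mul (by positivity),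
      ← Real.mul_rpow hb.le (norm_nonneg _)]
    exact ENNReal.ofReal_le_ofReal (Real.rpow_le_rpow (apply_nonneg _ _) (hab x).2 hp0)
  refine ⟨ENNReal.ofReal (a⁻¹ ^ p) * (ENNReal.ofReal C * ENNReal.ofReal (b ^ p)),
    by finiteness, ?_⟩
  intro S T _ _ P _ τ _ E hE n
  calc ∫⁻ z, ‖∑ k ∈ Finset.range n, E k z‖ₑ ^ p ∂((iidLaw ℕ P).prod τ)
      ≤ ENNReal.ofReal (a⁻¹ ^ p) *
        ∫⁻ z, ν.epow p (∑ k ∈ Finset.range n, E k z) ∂((iidLaw ℕ P).prod τ) := by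
        rw [← lintegral_const_mul' _ _ ENNReal.ofReal_ne_top]
        exact lintegral_mono fun z => h1 _
    _ ≤ ENNReal.ofReal (a⁻¹ ^ p) * (ENNReal.ofReal C * ∑ k ∈ Finset.range n,
        (ENNReal.ofReal (b ^ p) * ∫⁻ z, ‖E k z‖ₑ ^ p ∂((iidLaw ℕ P).prod τ))) := by
        gcongr
        refine (hν.lintegral_epow_sum_le hp hC hE n).trans ?_
        gcongr with k
        rw [← lintegral_const_mul' _ _ ENNReal.ofReal_ne_top]
        exact lintegral_mono fun z => h2 _
    _ = _ := by rw [← Finset.mul_sum]; ring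

/-! ### Powers of `L^p(τ; B)`-norms. -/

section npow

variable {T B : Type*} [MeasurableSpace T] [NormedAddCommGroup B]

/-- The `p`-th power of the `L^p(τ; B)`-norm. -/
noncomputable def npow (p : ℝ) (τ : Measure T) (f : T → B) : ℝ≥0∞ := ∫⁻ t, ‖f t‖ₑ ^ p ∂τ

variable {p : ℝ} {τ : Measure T}

lemma add_rpow_le_two_mul (hp : 1 ≤ p) (hp2 : p ≤ 2) (a b : ℝ≥0∞) :
    (a + b) ^ p ≤ 2 * (a ^ p + b ^ p) := by
  refine (ENNReal.rpow_add_le_mul_rpow_add_rpow a b hp).trans ?_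
  gcongr
  calc (2 : ℝ≥0∞) ^ (p - 1) ≤ 2 ^ (1 : ℝ) :=
        ENNReal.rpow_le_rpow_of_exponent_le (by norm_num) (by linarith)
    _ = 2 := by simp

lemma npow_le_of_enorm_le (hp : 1 ≤ p) (hp2 : p ≤ 2) {f g h : T → B}
    (hf : AEStronglyMeasurable f τ) (hle : ∀ t, ‖h t‖ₑ ≤ ‖f t‖ₑ + ‖g t‖ₑ) :
    npow p τ h ≤ 2 * (npow p τ f + npow p τ g) := by
  unfold npow
  rw [← lintegral_add_left' (by fun_prop), ← lintegral_const_mul' _ _ (by simp)]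
  refine lintegral_mono fun t => ?_
  exact (ENNReal.rpow_le_rpow (hle t) (by linarith)).trans (add_rpow_le_two_mul hp hp2 _ _)

lemma measurable_npow {X : Type*} [MeasurableSpace X] [SFinite τ] {f : X × T → B}
    (hf : StronglyMeasurable f) : Measurable fun x => npow p τ fun t => f (x, t) :=
  (hf.enorm.pow_const p).lintegral_prod_right'

lemma lintegral_npow {X : Type*} [MeasurableSpace X] {μ : Measure X} [SFinite τ] {f : X × T → B}
    (hf : StronglyMeasurable f) :
    ∫⁻ x, npow p τ (fun t => f (x, t)) ∂μ = ∫⁻ z, ‖f z‖ₑ ^ p ∂(μ.prod τ) :=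
  (lintegral_prod _ (hf.enorm.pow_const p).aemeasurable).symm

end npow

lemma measurable_finset_sup {X ι : Type*} [MeasurableSpace X] (F : Finset ι) {f : ι → X → ℝ≥0∞}
    (hf : ∀ i, Measurable (f i)) : Measurable fun x => F.sup fun i => f i x := by
  classical
  induction F using Finset.induction_on with
  | empty => simp
  | insert i F _ ih => simp_rw [Finset.sup_insert]; exact (hf i).sup ih

lemma exists_le_minimal {p : ℕ → Prop} {j : ℕ} (h : p j) : ∃ i ≤ j, p i ∧ ∀ k < i, ¬ p k := by
  classical
  exact ⟨Nat.find ⟨j, h⟩, Nat.find_min' _ h, Nat.find_spec _, fun k hk => Nat.find_min _ hk⟩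

/-! ### Good-`λ` inequality for martingales by stopping. -/

namespace IsMartDiff

variable {B S T : Type*} [NormedAddCommGroup B] [NormedSpace ℝ B]
  [MeasurableSpace S] [MeasurableSpace T] {P : Measure S} [IsProbabilityMeasure P]
  {τ : Measure T} [IsProbabilityMeasure τ] {E : ℕ → (ℕ → S) × T → B} {p : ℝ} {L D : ℝ≥0∞}

/-- The `p`-th power of the norm of a partial sum. -/
noncomputable def sumPow (p : ℝ) (τ : Measure T) (E : ℕ → (ℕ → S) × T → B) (j : ℕ) (x : ℕ → S) :
    ℝ≥0∞ := npow p τ fun t => ∑ k ∈ Finset.range j, E k (x, t)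

/-- The `p`-th power of the norm of an increment. -/
noncomputable def incPow (p : ℝ) (τ : Measure T) (E : ℕ → (ℕ → S) × T → B) (k : ℕ) (x : ℕ → S) :
    ℝ≥0∞ := npow p τ fun t => E k (x, t)

/-- The conditional `p`-th moment of an increment given the past. -/
noncomputable def varPow (p : ℝ) (P : Measure S) (τ : Measure T) (E : ℕ → (ℕ → S) × T → B)
    (k : ℕ) (x : ℕ → S) : ℝ≥0∞ := ∫⁻ y, incPow p τ E k (Function.update x k y) ∂P

/-- The event that step `k` is taken between the exceedance times of the levels `L` and `10 L`,
with increments and conditional moments bounded by `D`. -/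
def window (p : ℝ) (P : Measure S) (τ : Measure T) (E : ℕ → (ℕ → S) × T → B) (L D : ℝ≥0∞)
    (k : ℕ) : Set (ℕ → S) :=
  {x | (∃ j ∈ Finset.range (k + 1), L < sumPow p τ E j x) ∧
    (∀ j ∈ Finset.range (k + 1), sumPow p τ E j x ≤ 10 * L) ∧
    (∀ j ∈ Finset.range k, incPow p τ E j x ≤ D) ∧
    ∑ j ∈ Finset.range (k + 1), varPow p P τ E j x ≤ D}

lemma sumPow_update (hE : IsMartDiff P τ E) {j l : ℕ} (h : j ≤ l) (x : ℕ → S) (y : S) :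
    sumPow p τ E j (Function.update x l y) = sumPow p τ E j x := by
  unfold sumPow
  congr 1; ext t
  exact Finset.sum_congr rfl fun k hk => hE.2 k l ((Finset.mem_range.1 hk).trans_le h) _ _ _

lemma incPow_update (hE : IsMartDiff P τ E) {j l : ℕ} (h : j < l) (x : ℕ → S) (y : S) :
    incPow p τ E j (Function.update x l y) = incPow p τ E j x := by
  unfold incPow
  congr 1; ext t
  exact hE.2 j l h _ _ _

lemma varPow_update (hE : IsMartDiff P τ E) {j l : ℕ} (h : j ≤ l) (x : ℕ → S) (y : S) :
    varPow p P τ E j (Function.update x l y) = varPow p P τ E j x := by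
  refine lintegral_congr fun y' => ?_
  rcases h.eq_or_lt with rfl | h
  · rw [Function.update_idem]
  · rw [Function.update_comm h.ne', hE.incPow_update h]

/-- The window for step `k` involves only coordinates below `k`, even through `varPow` at `k`, where
coordinate `k` is integrated out. The window is therefore predictable, and restricting to it
preserves martingale differences. -/
lemma update_mem_window (hE : IsMartDiff P τ E) {k l : ℕ} (h : k ≤ l) (x : ℕ → S) (y : S) :
    Function.update x l y ∈ window p P τ E L D k ↔ x ∈ window p P τ E L D k := by
  have h1 : ∀ j ∈ Finset.range (k + 1), sumPow p τ E j (Function.update x l y) = sumPow p τ E j x :=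
    fun j hj => hE.sumPow_update (by have := Finset.mem_range.1 hj; omega) _ _
  have h2 : ∀ j ∈ Finset.range k, incPow p τ E j (Function.update x l y) = incPow p τ E j x :=
    fun j hj => hE.incPow_update (by have := Finset.mem_range.1 hj; omega) _ _
  have h3 : ∑ j ∈ Finset.range (k + 1), varPow p P τ E j (Function.update x l y)
      = ∑ j ∈ Finset.range (k + 1), varPow p P τ E j x :=
    Finset.sum_congr rfl fun j hj => hE.varPow_update (by have := Finset.mem_range.1 hj; omega) _ _
  simp only [window, Set.mem_ofPred_eq, h3]
  refine and_congr ?_ (and_congr ?_ (and_congr ?_ Iff.rfl))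
  · exact exists_congr fun j => and_congr_right fun hj => by rw [h1 j hj]
  · exact forall₂_congr fun j hj => by rw [h1 j hj]
  · exact forall₂_congr fun j hj => by rw [h2 j hj]

lemma measurable_sumPow (hE : IsMartDiff P τ E) (j : ℕ) : Measurable (sumPow p τ E j) :=
  measurable_npow (f := fun z => ∑ k ∈ Finset.range j, E k z)
    (Finset.stronglyMeasurable_fun_sum _ fun k _ => hE.1 k)

lemma measurable_incPow (hE : IsMartDiff P τ E) (j : ℕ) : Measurable (incPow p τ E j) :=
  measurable_npow (hE.1 j)

lemma measurable_varPow (hE : IsMartDiff P τ E) (j : ℕ) : Measurable (varPow p P τ E j) :=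
  ((hE.measurable_incPow j).comp (measurePreserving_update P j).measurable).lintegral_prod_right'

lemma measurableSet_window (hE : IsMartDiff P τ E) (k : ℕ) :
    MeasurableSet (window p P τ E L D k) := by
  have h1 := fun j => hE.measurable_sumPow (p := p) j
  have h2 := fun j => hE.measurable_incPow (p := p) j
  have h3 := fun j => hE.measurable_varPow (p := p) j
  have e : window p P τ E L D k =
      (⋃ j ∈ Finset.range (k + 1), {x | L < sumPow p τ E j x}) ∩
      ((⋂ j ∈ Finset.range (k + 1), {x | sumPow p τ E j x ≤ 10 * L}) ∩
      ((⋂ j ∈ Finset.range k, {x | incPow p τ E j x ≤ D}) ∩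
      {x | ∑ j ∈ Finset.range (k + 1), varPow p P τ E j x ≤ D})) := by
    ext x
    simp only [window, Set.mem_ofPred_eq, Set.mem_inter_iff, Set.mem_iUnion, Set.mem_iInter,
      exists_prop]
  rw [e]
  refine (Finset.measurableSet_biUnion _ fun j _ => measurableSet_lt measurable_const (h1 j)).inter
    ((Finset.measurableSet_biInter _ fun j _ => measurableSet_le (h1 j) measurable_const).inter
    ((Finset.measurableSet_biInter _ fun j _ => measurableSet_le (h2 j) measurable_const).inter
    (measurableSet_le (Finset.measurable_fun_sum _ fun j _ => h3 j) measurable_const)))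

/-- The increments restricted to the window. -/
noncomputable def stopped (p : ℝ) (P : Measure S) (τ : Measure T) (E : ℕ → (ℕ → S) × T → B)
    (L D : ℝ≥0∞) (k : ℕ) (z : (ℕ → S) × T) : B :=
  (window p P τ E L D k).indicator (fun x => E k (x, z.2)) z.1

lemma isMartDiff_stopped (hE : IsMartDiff P τ E) : IsMartDiff P τ (stopped p P τ E L D) where
  stronglyMeasurable k := by
    have : stopped p P τ E L D k
        = (Prod.fst ⁻¹' window p P τ E L D k).indicator (E k) := by
      rfl
    rw [this]
    exact (hE.1 k).indicator (measurable_fst (hE.measurableSet_window k))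
  adapted k l h x y t := by
    classical
    simp only [stopped, Set.indicator_apply, hE.update_mem_window h.le, hE.2 k l h]
  integrable k := by
    classical
    filter_upwards [hE.3 k] with z hz
    by_cases h : z.1 ∈ window p P τ E L D k
    · simpa [stopped, Set.indicator_apply, hE.update_mem_window le_rfl, h] using hz
    · simp [stopped, hE.update_mem_window le_rfl, h]
  integral_eq_zero k := by
    classical
    filter_upwards [hE.4 k] with z hz
    by_cases h : z.1 ∈ window p P τ E L D k
    · simpa [stopped, Set.indicator_apply, hE.update_mem_window le_rfl, h] using hz
    · simp [stopped, hE.update_mem_window le_rfl, h]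

/-- Let `j₁ ≤ j₂` be the first indices at which the levels `L` and `10 * L` are exceeded. The active
steps are exactly `j₁ ≤ k < j₂`, so the stopped sum is a difference of two partial sums. The
overshoot at `j₁` is one increment, hence the power there is at most `2 * (L + D) ≤ 4 * L`, and the
level `10 = 2 * 4 + 2` leaves `L` for the stopped sum. -/
lemma le_sumPow_stopped (hE : IsMartDiff P τ E) (hp : 1 ≤ p) (hp2 : p ≤ 2) (hL : L ≠ ∞)
    (hDL : D ≤ L) {N : ℕ} {x : ℕ → S} (h1 : ∃ j ≤ N, 10 * L < sumPow p τ E j x)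
    (h2 : ∀ k < N, incPow p τ E k x ≤ D) (h3 : ∑ k ∈ Finset.range N, varPow p P τ E k x ≤ D) :
    L ≤ sumPow p τ (stopped p P τ E L D) N x := by
  classical
  have hp0 : 0 < p := by linarith
  obtain ⟨j₂, hj₂N, hj₂, hmin₂⟩ : ∃ j ≤ N, 10 * L < sumPow p τ E j x ∧
      ∀ i < j, sumPow p τ E i x ≤ 10 * L := by
    obtain ⟨j, hj, hj'⟩ := h1
    obtain ⟨i, hi, h, hmin⟩ := exists_le_minimal (p := fun j => 10 * L < sumPow p τ E j x) hj'
    exact ⟨i, hi.trans hj, h, fun k hk => not_lt.1 (hmin k hk)⟩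
  have hle : L ≤ 10 * L := le_mul_of_one_le_left' (by norm_num)
  obtain ⟨j₁, hj₁₂, hj₁, hmin₁⟩ : ∃ j ≤ j₂, L < sumPow p τ E j x ∧
      ∀ i < j, sumPow p τ E i x ≤ L := by
    have hj' : L < sumPow p τ E j₂ x := hle.trans_lt hj₂
    obtain ⟨i, hi, h, hmin⟩ := exists_le_minimal (p := fun j => L < sumPow p τ E j x) hj'
    exact ⟨i, hi, h, fun k hk => not_lt.1 (hmin k hk)⟩
  have hmem : ∀ k < N, x ∈ window p P τ E L D k ↔ j₁ ≤ k ∧ k < j₂ := by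
    intro k hk
    constructor
    · rintro ⟨⟨j, hj, hjL⟩, h10, -, -⟩
      constructor
      · by_contra hcon
        have := Finset.mem_range.1 hj
        exact absurd hjL (not_lt.2 (hmin₁ j (by omega)))
      · by_contra hcon
        exact absurd hj₂ (not_lt.2 (h10 j₂ (Finset.mem_range.2 (by omega))))
    · rintro ⟨ha, hb⟩
      refine ⟨⟨j₁, Finset.mem_range.2 (by omega), hj₁⟩, fun j hj => hmin₂ j ?_, fun j hj => h2 j ?_,
        (Finset.sum_le_sum_of_subset ?_).trans h3⟩
      · have := Finset.mem_range.1 hj; omega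
      · have := Finset.mem_range.1 hj; omega
      · exact Finset.range_subset_range.2 (by omega)
  have hsum : ∀ t, ∑ k ∈ Finset.range N, stopped p P τ E L D k (x, t)
      = ∑ k ∈ Finset.range j₂, E k (x, t) - ∑ k ∈ Finset.range j₁, E k (x, t) := by
    intro t
    rw [← Finset.sum_Ico_eq_sub _ hj₁₂]
    have : ∀ k ∈ Finset.range N, stopped p P τ E L D k (x, t)
        = if k ∈ Finset.Ico j₁ j₂ then E k (x, t) else 0 := fun k hk => by
      simp only [stopped, Set.indicator_apply, hmem k (Finset.mem_range.1 hk), Finset.mem_Ico]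
    rw [Finset.sum_congr rfl this, ← Finset.sum_filter]
    congr 1
    ext k; simp only [Finset.mem_filter, Finset.mem_range, Finset.mem_Ico]; omega
  have hmeas : ∀ j, AEStronglyMeasurable (fun t => ∑ k ∈ Finset.range j, E k (x, t)) τ := fun j =>
    (Finset.stronglyMeasurable_fun_sum _ fun k _ =>
      (hE.1 k).comp_measurable measurable_prodMk_left).aestronglyMeasurable
  -- The empty sum exceeds no level, so some step `i` leads to `j₁ = i + 1`.
  have hj₁pos : j₁ ≠ 0 := by
    rintro rfl
    simp [sumPow, npow, hp0] at hj₁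
  obtain ⟨i, rfl⟩ := Nat.exists_eq_succ_of_ne_zero hj₁pos
  have e1 : sumPow p τ E (i + 1) x ≤ 4 * L := by
    have := npow_le_of_enorm_le hp hp2 (h := fun t => ∑ k ∈ Finset.range (i + 1), E k (x, t))
      (g := fun t => E i (x, t)) (hmeas i)
      fun t => by rw [Finset.sum_range_succ]; exact enorm_add_le _ _
    calc sumPow p τ E (i + 1) x ≤ 2 * (sumPow p τ E i x + incPow p τ E i x) := this
      _ ≤ 2 * (L + L) := by
        gcongr
        · exact hmin₁ i (Nat.lt_succ_self i)
        · exact (h2 i (by omega)).trans hDL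
      _ = 4 * L := by ring
  have e2 : sumPow p τ E j₂ x ≤ 2 * (sumPow p τ E (i + 1) x +
      sumPow p τ (stopped p P τ E L D) N x) := by
    refine npow_le_of_enorm_le hp hp2 (hmeas (i + 1)) fun t => ?_
    rw [hsum]
    refine le_trans (le_of_eq ?_) (enorm_add_le _ _)
    congr 1; abel
  have e3 : 2 * (4 * L) + 2 * L ≤ 2 * (4 * L) + 2 * sumPow p τ (stopped p P τ E L D) N x := by
    calc 2 * (4 * L) + 2 * L = 10 * L := by ring
      _ ≤ sumPow p τ E j₂ x := hj₂.le
      _ ≤ _ := e2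
      _ ≤ 2 * (4 * L + sumPow p τ (stopped p P τ E L D) N x) := by gcongr
      _ = _ := by ring
  rw [ENNReal.add_le_add_iff_left (by finiteness)] at e3
  exact (ENNReal.mul_le_mul_iff_right (by simp) (by simp)).1 e3

end IsMartDiff

section goodLambda

open IsMartDiff

variable {p : ℝ} {C : ℝ≥0∞}

/-- Markov's inequality for the stopped martingale. Its `p`-th moment is at most `C` times the
expected sum of conditional moments over the active steps; that sum is at most `δ * L` and vanishes
unless level `L` is exceeded. -/
lemma HasMartingaleType.measure_goodLambda_le.{u, v} {B : Type v} [NormedAddCommGroup B]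
    [NormedSpace ℝ B] {S T : Type u} [MeasurableSpace S] [MeasurableSpace T] {P : Measure S}
    [IsProbabilityMeasure P] {τ : Measure T} [IsProbabilityMeasure τ] {E : ℕ → (ℕ → S) × T → B}
    (hB : HasMartingaleType.{u, v} p C B) (hE : IsMartDiff P τ E) (hp : 1 ≤ p) (hp2 : p ≤ 2)
    {L δ : ℝ≥0∞} (hL0 : L ≠ 0) (hL : L ≠ ∞) (hδ : δ ≤ 1) (N : ℕ) :
    iidLaw ℕ P {x | 10 * L < (Finset.range (N + 1)).sup fun j => sumPow p τ E j x}
      ≤ C * δ * iidLaw ℕ P {x | L < (Finset.range (N + 1)).sup fun j => sumPow p τ E j x}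
        + (iidLaw ℕ P {x | δ * L < (Finset.range N).sup fun k => incPow p τ E k x}
          + iidLaw ℕ P {x | δ * L < ∑ k ∈ Finset.range N, varPow p P τ E k x}) := by
  set D := δ * L with hD
  have hDL : D ≤ L := mul_le_of_le_one_left' hδ
  set μ := iidLaw ℕ P
  set Y := sumPow p τ (stopped p P τ E L D) N
  set G := {x | L < (Finset.range (N + 1)).sup fun j => sumPow p τ E j x} with hG
  have hGm : MeasurableSet G := by
    exact measurableSet_lt measurable_const (measurable_finset_sup _ fun j => hE.measurable_sumPow j)
  have hst := hE.isMartDiff_stopped (p := p) (L := L) (D := D)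
  have hcov : {x | 10 * L < (Finset.range (N + 1)).sup fun j => sumPow p τ E j x} ⊆
      {x | L ≤ Y x} ∪ ({x | D < (Finset.range N).sup fun k => incPow p τ E k x}
        ∪ {x | D < ∑ k ∈ Finset.range N, varPow p P τ E k x}) := by
    intro x hx
    by_contra hcon
    simp only [Set.mem_union, Set.mem_ofPred_eq, not_or, not_lt] at hcon hx
    refine hcon.1 (le_sumPow_stopped hE hp hp2 hL hDL ?_ ?_ hcon.2.2)
    · obtain ⟨j, hj, h⟩ := Finset.lt_sup_iff.1 hx
      exact ⟨j, Nat.lt_succ_iff.1 (Finset.mem_range.1 hj), h⟩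
    · exact fun k hk => (Finset.le_sup (f := fun k => incPow p τ E k x)
        (Finset.mem_range.2 hk)).trans hcon.2.1
  have hvar : ∀ k, ∫⁻ z, ‖stopped p P τ E L D k z‖ₑ ^ p ∂(μ.prod τ)
      = ∫⁻ x, (window p P τ E L D k).indicator (varPow p P τ E k) x ∂μ := by
    classical
    intro k
    have hp0 : 0 < p := by linarith
    rw [← lintegral_npow (hst.1 k)]
    have e : ∀ x, npow p τ (fun t => stopped p P τ E L D k (x, t))
        = (window p P τ E L D k).indicator (incPow p τ E k) x := by
      intro x
      by_cases h : x ∈ window p P τ E L D k <;> simp [stopped, h, incPow, npow, hp0]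
    have hm : Measurable ((window p P τ E L D k).indicator (incPow p τ E k)) :=
      (hE.measurable_incPow k).indicator (hE.measurableSet_window k)
    simp_rw [e]
    rw [← (measurePreserving_update P k).lintegral_comp hm,
      lintegral_prod (fun z : (ℕ → S) × S => (window p P τ E L D k).indicator (incPow p τ E k)
        (Function.update z.1 k z.2))
        (hm.comp (measurePreserving_update P k).measurable).aemeasurable]
    refine lintegral_congr fun x => ?_
    by_cases h : x ∈ window p P τ E L D k
    · simp [hE.update_mem_window le_rfl, h, varPow]
    · simp [hE.update_mem_window le_rfl, h]
  have hY : ∫⁻ x, Y x ∂μ ≤ C * (D * μ G) := by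
    calc ∫⁻ x, Y x ∂μ
        = ∫⁻ z, ‖∑ k ∈ Finset.range N, stopped p P τ E L D k z‖ₑ ^ p ∂(μ.prod τ) :=
          lintegral_npow (f := fun z => ∑ k ∈ Finset.range N, stopped p P τ E L D k z)
            (Finset.stronglyMeasurable_fun_sum _ fun k _ => hst.1 k)
      _ ≤ C * ∑ k ∈ Finset.range N, ∫⁻ z, ‖stopped p P τ E L D k z‖ₑ ^ p ∂(μ.prod τ) :=
          hB S T P τ _ hst N
      _ = C * ∫⁻ x, ∑ k ∈ Finset.range N,
            (window p P τ E L D k).indicator (varPow p P τ E k) x ∂μ := by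
          rw [lintegral_finsetSum _ fun k _ =>
            (hE.measurable_varPow k).indicator (hE.measurableSet_window k)]
          simp_rw [hvar]
      _ ≤ C * ∫⁻ x, G.indicator (fun _ => D) x ∂μ := by
          classical
          gcongr with x
          by_cases hx : ∃ k ∈ Finset.range N, x ∈ window p P τ E L D k
          -- The last active step: its window condition bounds the sum of all conditional moments up
          -- to and including that step.
          · obtain ⟨k, hk, hxk, hmax⟩ : ∃ k ∈ Finset.range N, x ∈ window p P τ E L D k ∧
                ∀ i ∈ Finset.range N, x ∈ window p P τ E L D i → i ≤ k := by
              obtain ⟨k, hk⟩ := hx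
              have hne : ((Finset.range N).filter fun k => x ∈ window p P τ E L D k).Nonempty :=
                ⟨k, by simpa using hk⟩
              have hmem := Finset.mem_filter.1 (Finset.max'_mem _ hne)
              exact ⟨_, hmem.1, hmem.2, fun i hi hxi =>
                Finset.le_max' _ _ (Finset.mem_filter.2 ⟨hi, hxi⟩)⟩
            have hxG : x ∈ G := by
              obtain ⟨j, hj, hjL⟩ := hxk.1
              refine lt_of_lt_of_le hjL (Finset.le_sup (f := fun j => sumPow p τ E j x) ?_)
              have := Finset.mem_range.1 hj
              have := Finset.mem_range.1 hk
              exact Finset.mem_range.2 (by omega)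
            rw [Set.indicator_of_mem hxG]
            refine le_trans ?_ hxk.2.2.2
            simp_rw [Set.indicator_apply]
            rw [← Finset.sum_filter]
            refine Finset.sum_le_sum_of_subset fun i hi => ?_
            rw [Finset.mem_filter] at hi
            exact Finset.mem_range.2 (Nat.lt_succ_iff.2 (hmax i hi.1 hi.2))
          · rw [Finset.sum_eq_zero]
            · exact zero_le
            · exact fun k hk => Set.indicator_of_notMem (fun h => hx ⟨k, hk, h⟩) _
      _ = C * (D * μ G) := by rw [lintegral_indicator_const hGm]
  calc _ ≤ _ := measure_mono hcov
    _ ≤ μ {x | L ≤ Y x} + _ := measure_union_le _ _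
    _ ≤ C * δ * μ G + _ := by
        gcongr
        · refine (meas_ge_le_lintegral_div (hst.measurable_sumPow N).aemeasurable hL0 hL).trans ?_
          rw [ENNReal.div_le_iff hL0 hL]
          refine hY.trans (le_of_eq ?_)
          rw [hD]; ring
        · exact measure_union_le _ _

/-- Good-`λ` inequality between the maximum of a martingale, its increments and its conditional
moments, in integrated form. -/
lemma exists_tailInt_sumPow_le.{u, v} {q : ℝ} (hp : 1 ≤ p) (hp2 : p ≤ 2) (hq : 0 < q) (hC : C ≠ ∞) :
    ∃ K : ℝ≥0∞, K ≠ ∞ ∧ ∀ (B : Type v) [NormedAddCommGroup B] [NormedSpace ℝ B],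
      HasMartingaleType.{u, v} p C B → ∀ (S T : Type u) [MeasurableSpace S] [MeasurableSpace T]
      (P : Measure S) [IsProbabilityMeasure P] (τ : Measure T) [IsProbabilityMeasure τ]
      (E : ℕ → (ℕ → S) × T → B), IsMartDiff P τ E → ∀ (N : ℕ) (s : ℝ), 0 < s →
      tailInt p q (iidLaw ℕ P) (fun x => (Finset.range (N + 1)).sup fun j => sumPow p τ E j x) s
        ≤ K * (tailInt p q (iidLaw ℕ P) (fun x => (Finset.range N).sup fun k => incPow p τ E k x) s
          + tailInt p q (iidLaw ℕ P) (fun x => ∑ k ∈ Finset.range N, varPow p P τ E k x) s) := by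
  have hp0 : 0 < p := by linarith
  -- Levels have the form `s * u ^ p`, so multiplying `u` by `b` multiplies the level by `10`.
  set b : ℝ := 10 ^ (1 / p) with hb
  have hb1 : 1 < b := Real.one_lt_rpow (by norm_num) (by positivity)
  have hbp : b ^ p = 10 := by
    rw [hb, ← Real.rpow_mul (by norm_num), one_div_mul_cancel hp0.ne', Real.rpow_one]
  obtain ⟨δ, hδ0, hδ1, hδ⟩ : ∃ δ : ℝ, 0 < δ ∧ δ ≤ 1 ∧
      ENNReal.ofReal (b ^ q) * (C * ENNReal.ofReal δ) ≤ 1 / 2 := by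
    lift C to ℝ≥0 using hC
    have hbq : 0 < b ^ q := by positivity
    -- Small enough for absorption; `C + 1` keeps the denominator positive when `C = 0`.
    refine ⟨min 1 (1 / (2 * (b ^ q * (C + 1)))), by positivity, min_le_left _ _, ?_⟩
    rw [← ENNReal.ofReal_coe_nnreal, ← ENNReal.ofReal_mul C.coe_nonneg, ← ENNReal.ofReal_mul hbq.le,
      show (1 / 2 : ℝ≥0∞) = ENNReal.ofReal (1 / 2) by
        rw [ENNReal.ofReal_div_of_pos (by norm_num)]; simp]
    refine ENNReal.ofReal_le_ofReal ?_
    calc b ^ q * (C * min 1 (1 / (2 * (b ^ q * (C + 1)))))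
        ≤ b ^ q * ((C + 1) * (1 / (2 * (b ^ q * (C + 1))))) := by
          gcongr
          · linarith
          · exact min_le_right _ _
      _ = 1 / 2 := by field_simp
  refine ⟨2 * ENNReal.ofReal (b ^ q) * ENNReal.ofReal (δ ^ (-(q / p))), by finiteness, ?_⟩
  intro B _ _ hB S T _ _ P _ τ _ E hE N s hs
  have hgl := weightInt_le_of_goodLambda hq hb1 hδ
    (F := fun u => iidLaw ℕ P
      {x | ENNReal.ofReal (s * u ^ p) < (Finset.range (N + 1)).sup fun j => sumPow p τ E j x})
    (M := fun u =>
      iidLaw ℕ P {x | ENNReal.ofReal (δ * s * u ^ p) <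
        (Finset.range N).sup fun k => incPow p τ E k x}
      + iidLaw ℕ P {x | ENNReal.ofReal (δ * s * u ^ p) <
        ∑ k ∈ Finset.range N, varPow p P τ E k x})
    (measurable_measure_lt _ _ _ _) (fun u => prob_le_one) fun u hu => by
      have h := hB.measure_goodLambda_le hE hp hp2 (L := ENNReal.ofReal (s * u ^ p))
        (δ := ENNReal.ofReal δ) (by simpa using mul_pos hs (by positivity)) ENNReal.ofReal_ne_top
        (by simpa using hδ1) N
      rw [← ENNReal.ofReal_mul hδ0.le, show (10 : ℝ≥0∞) = ENNReal.ofReal 10 by simp,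
        ← ENNReal.ofReal_mul (by norm_num)] at h
      rw [Real.mul_rpow (by positivity) hu.le, hbp, mul_assoc δ, mul_left_comm s]
      exact h
  rw [weightInt_add (measurable_measure_lt _ _ _ _)] at hgl
  refine hgl.trans ?_
  rw [mul_assoc (2 * ENNReal.ofReal (b ^ q)), mul_add (ENNReal.ofReal (δ ^ (-(q / p))))]
  exact mul_le_mul_right (add_le_add (tailInt_mul_le hp0 hδ0 hδ1 _)
    (tailInt_mul_le hp0 hδ0 hδ1 _)) _

end goodLambda

/-! ### U-statistics with a parameter and their recursion in the sample size. -/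

section uSum

variable {B S T : Type*} [NormedAddCommGroup B] {m : ℕ}

/-- Strictly increasing `m`-tuples of indices below `n`. -/
def incTuples (m n : ℕ) : Finset (Fin m → ℕ) :=
  (Fintype.piFinset fun _ : Fin m => Finset.range n).filter StrictMono

lemma mem_incTuples {n : ℕ} {i : Fin m → ℕ} :
    i ∈ incTuples m n ↔ (∀ l, i l < n) ∧ StrictMono i := by
  simp [incTuples]

/-- The `U`-statistic with a kernel depending on a parameter. -/
def uSum (h : (Fin m → S) × T → B) (n : ℕ) (z : (ℕ → S) × T) : B :=
  ∑ i ∈ incTuples m n, h (fun l => z.1 (i l), z.2)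

/-- The kernel with its last argument turned into a parameter. -/
def addParam (h : (Fin (m + 1) → S) × T → B) (w : (Fin m → S) × (S × T)) : B :=
  h (snocArg w.1 w.2.1, w.2.2)

@[simp] lemma snocArg_castSucc (x : Fin m → S) (s : S) (l : Fin m) :
    snocArg x s l.castSucc = x l := by simp [snocArg]

@[simp] lemma snocArg_last (x : Fin m → S) (s : S) : snocArg x s (Fin.last m) = s := by
  simp [snocArg]

lemma uSum_update {h : (Fin m → S) × T → B} {n l : ℕ} (hl : n ≤ l) (x : ℕ → S) (y : S) (t : T) :
    uSum h n (Function.update x l y, t) = uSum h n (x, t) := by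
  refine Finset.sum_congr rfl fun i hi => ?_
  congr 2
  ext k
  exact Function.update_of_ne (((mem_incTuples.1 hi).1 k).trans_le hl).ne _ _

lemma uSum_zero_right (h : (Fin (m + 1) → S) × T → B) (z : (ℕ → S) × T) : uSum h 0 z = 0 := by
  refine Finset.sum_eq_zero fun i hi => ?_
  exact absurd ((mem_incTuples.1 hi).1 0) (Nat.not_lt_zero _)

lemma uSum_zero_left (h : (Fin 0 → S) × T → B) (n : ℕ) (z : (ℕ → S) × T) :
    uSum h n z = h (fun l => z.1 l, z.2) := by
  have : incTuples 0 n = {fun l => l.elim0} := by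
    ext i
    rw [mem_incTuples, Finset.mem_singleton]
    exact ⟨fun _ => funext fun l => l.elim0, fun _ => ⟨fun l => l.elim0, fun l => l.elim0⟩⟩
  rw [uSum, this, Finset.sum_singleton]
  congr 2
  ext l; exact l.elim0

lemma strictMono_snocArg {i : Fin m → ℕ} {n : ℕ} (hi : i ∈ incTuples m n) :
    StrictMono (snocArg i n) := by
  obtain ⟨h1, h2⟩ := mem_incTuples.1 hi
  intro a b
  refine Fin.lastCases ?_ (fun a => ?_) a <;> refine Fin.lastCases ?_ (fun b => ?_) b
  · simp
  · intro h; exact absurd h (not_lt.2 (Fin.le_last _))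
  · intro _; simpa using h1 a
  · intro h; simpa using h2 (by simpa using h)

lemma snocArg_castSucc_last (i : Fin (m + 1) → S) :
    snocArg (fun l => i l.castSucc) (i (Fin.last m)) = i := by
  ext l
  refine Fin.lastCases ?_ (fun l => ?_) l <;> simp

/-- The new tuples are those whose largest entry is `n`; deleting that entry leaves an increasing
tuple below `n`. -/
lemma uSum_succ (h : (Fin (m + 1) → S) × T → B) (n : ℕ) (z : (ℕ → S) × T) :
    uSum h (n + 1) z = uSum h n z + uSum (addParam h) n (z.1, (z.1 n, z.2)) := by
  unfold uSum
  rw [← Finset.sum_filter_not_add_sum_filter (incTuples (m + 1) (n + 1))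
    (fun i => i (Fin.last m) = n)]
  congr 1
  · congr 1
    ext i
    simp only [Finset.mem_filter, mem_incTuples]
    constructor
    · rintro ⟨⟨h1, h2⟩, h3⟩
      refine ⟨fun l => lt_of_le_of_lt (h2.monotone (Fin.le_last l)) ?_, h2⟩
      have := h1 (Fin.last m)
      omega
    · rintro ⟨h1, h2⟩
      exact ⟨⟨fun l => (h1 l).trans (Nat.lt_succ_self n), h2⟩, (h1 _).ne⟩
  · refine Finset.sum_bij' (fun i _ => fun l => i l.castSucc) (fun i _ => snocArg i n)
      ?_ ?_ ?_ ?_ ?_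
    · intro i hi
      simp only [Finset.mem_filter, mem_incTuples] at hi ⊢
      exact ⟨fun l => by rw [← hi.2]; exact hi.1.2 (Fin.castSucc_lt_last l),
        fun a b hab => hi.1.2 (by simpa using hab)⟩
    · intro i hi
      simp only [Finset.mem_filter, mem_incTuples, snocArg_last, and_true]
      refine ⟨fun l => ?_, strictMono_snocArg hi⟩
      refine Fin.lastCases ?_ (fun l => ?_) l
      · simp
      · simpa using ((mem_incTuples.1 hi).1 l).trans (Nat.lt_succ_self n)
    · intro i hi
      have := (Finset.mem_filter.1 hi).2
      conv_rhs => rw [← snocArg_castSucc_last i]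
      rw [this]
    · intro i hi
      ext l; simp
    · intro i hi
      have := (Finset.mem_filter.1 hi).2
      simp only [addParam]
      congr 2
      ext l
      refine Fin.lastCases ?_ (fun l => ?_) l <;> simp [this]

lemma uSum_eq_sum_range (h : (Fin (m + 1) → S) × T → B) (n : ℕ) (z : (ℕ → S) × T) :
    uSum h n z = ∑ k ∈ Finset.range n, uSum (addParam h) k (z.1, (z.1 k, z.2)) := by
  induction n with
  | zero => simp [uSum_zero_right]
  | succ n ih => rw [uSum_succ, ih, Finset.sum_range_succ]

variable [MeasurableSpace S] [MeasurableSpace T]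

lemma measurable_snocArg : Measurable fun z : (Fin m → S) × S => snocArg z.1 z.2 := by
  refine measurable_pi_iff.2 fun l => ?_
  refine Fin.lastCases ?_ (fun l => ?_) l
  · simpa using measurable_snd
  · simp only [snocArg_castSucc]; fun_prop

lemma measurable_addParamMap :
    Measurable fun w : (Fin m → S) × (S × T) => (snocArg w.1 w.2.1, w.2.2) :=
  (measurable_snocArg.comp (f := fun w : (Fin m → S) × (S × T) => (w.1, w.2.1))
    (by fun_prop)).prodMk (by fun_prop)

lemma stronglyMeasurable_addParam {h : (Fin (m + 1) → S) × T → B} (hh : StronglyMeasurable h) :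
    StronglyMeasurable (addParam h) := hh.comp_measurable measurable_addParamMap

lemma stronglyMeasurable_uSum {h : (Fin m → S) × T → B} (hh : StronglyMeasurable h) (n : ℕ) :
    StronglyMeasurable (uSum h n) :=
  Finset.stronglyMeasurable_fun_sum _ fun i _ => hh.comp_measurable (by fun_prop)

variable {P : Measure S} [IsProbabilityMeasure P] {τ : Measure T} [IsProbabilityMeasure τ]

lemma measurePreserving_addParam :
    MeasurePreserving (fun w : (Fin m → S) × (S × T) => (snocArg w.1 w.2.1, w.2.2))
      ((iidLaw (Fin m) P).prod (P.prod τ)) ((iidLaw (Fin (m + 1)) P).prod τ) :=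
  ((measurePreserving_snocArg P m).prod (MeasurePreserving.id τ)).comp
    (measurePreserving_prodAssoc _ _ _).symm

lemma measurePreserving_incTuple {n : ℕ} {i : Fin m → ℕ} (hi : i ∈ incTuples m n) :
    MeasurePreserving (fun z : (ℕ → S) × T => ((fun l => z.1 (i l), z.2) : (Fin m → S) × T))
      ((iidLaw ℕ P).prod τ) ((iidLaw (Fin m) P).prod τ) :=
  (measurePreserving_comp_injective P (mem_incTuples.1 hi).2.injective).prod
    (MeasurePreserving.id τ)

/-- The law of the parameter can be exchanged with the law of the first component. -/
lemma measurePreserving_prod_left_comm {α β γ : Type*} [MeasurableSpace α] [MeasurableSpace β]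
    [MeasurableSpace γ] (μ₁ : Measure α) (μ₂ : Measure β) (μ₃ : Measure γ) [SFinite μ₁]
    [SFinite μ₂] [SFinite μ₃] :
    MeasurePreserving (fun z : β × (α × γ) => (z.2.1, (z.1, z.2.2)))
      (μ₂.prod (μ₁.prod μ₃)) (μ₁.prod (μ₂.prod μ₃)) :=
  ((measurePreserving_prodAssoc μ₁ μ₂ μ₃).comp
    ((Measure.measurePreserving_swap (μ := μ₂) (ν := μ₁)).prod (MeasurePreserving.id μ₃))).comp
      (measurePreserving_prodAssoc μ₂ μ₁ μ₃).symm

end uSum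

/-! ### Operations on the last argument and partial moments of a kernel. -/

section kernels

lemma enorm_integral_rpow_le {α B : Type*} [MeasurableSpace α] [NormedAddCommGroup B]
    [NormedSpace ℝ B] {μ : Measure α} [IsProbabilityMeasure μ] {p : ℝ} (hp : 1 ≤ p) {f : α → B}
    (hf : AEStronglyMeasurable f μ) : ‖∫ a, f a ∂μ‖ₑ ^ p ≤ ∫⁻ a, ‖f a‖ₑ ^ p ∂μ := by
  have hp0 : 0 < p := by linarith
  have h1 := eLpNorm'_le_eLpNorm'_of_exponent_le one_pos hp μ hf
  simp only [eLpNorm', ENNReal.rpow_one, div_one] at h1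
  calc ‖∫ a, f a ∂μ‖ₑ ^ p ≤ ((∫⁻ a, ‖f a‖ₑ ^ p ∂μ) ^ (1 / p)) ^ p :=
        ENNReal.rpow_le_rpow ((enorm_integral_le_lintegral_enorm f).trans h1) hp0.le
    _ = _ := by rw [← ENNReal.rpow_mul, one_div_mul_cancel hp0.ne', ENNReal.rpow_one]

variable {B S T : Type*} [NormedAddCommGroup B] [NormedSpace ℝ B] {m : ℕ}
  [MeasurableSpace S] [MeasurableSpace T] {P : Measure S} [IsProbabilityMeasure P]
  {τ : Measure T} [IsProbabilityMeasure τ] {p q s : ℝ}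

/-- The first arguments, without the last one. -/
def initArg (x : Fin (m + 1) → S) : Fin m → S := fun l => x l.castSucc

@[simp] lemma initArg_snocArg (x : Fin m → S) (s : S) : initArg (snocArg x s) = x := by
  ext l; simp [initArg]

lemma measurePreserving_initArg :
    MeasurePreserving (initArg (S := S) (m := m)) (iidLaw (Fin (m + 1)) P) (iidLaw (Fin m) P) :=
  measurePreserving_comp_injective P (Fin.castSucc_injective m)

/-- The kernel with its last argument fixed. -/
def fixLast (h : (Fin (m + 1) → S) × T → B) (s : S) (w : (Fin m → S) × T) : B :=
  h (snocArg w.1 s, w.2)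

/-- The kernel with its last argument integrated out. -/
noncomputable def meanLast (P : Measure S) (h : (Fin (m + 1) → S) × T → B) (w : (Fin m → S) × T) :
    B := ∫ s, h (snocArg w.1 s, w.2) ∂P

/-- A kernel seen as a kernel with one more argument. -/
def forgetLast (f : (Fin m → S) × T → B) (w : (Fin (m + 1) → S) × T) : B := f (initArg w.1, w.2)

/-- The kernel centred in its last argument. -/
noncomputable def centreLast (P : Measure S) (h : (Fin (m + 1) → S) × T → B)
    (w : (Fin (m + 1) → S) × T) : B := h w - forgetLast (meanLast P h) w

lemma stronglyMeasurable_fixLast {h : (Fin (m + 1) → S) × T → B} (hh : StronglyMeasurable h)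
    (s : S) : StronglyMeasurable (fixLast h s) :=
  hh.comp_measurable <| Measurable.prodMk
    (measurable_snocArg.comp (f := fun w : (Fin m → S) × T => (w.1, s)) (by fun_prop)) (by fun_prop)

lemma stronglyMeasurable_meanLast {h : (Fin (m + 1) → S) × T → B} (hh : StronglyMeasurable h) :
    StronglyMeasurable (meanLast P h) := by
  have : StronglyMeasurable fun w : ((Fin m → S) × T) × S => h (snocArg w.1.1 w.2, w.1.2) :=
    hh.comp_measurable <| Measurable.prodMk (measurable_snocArg.comp
      (f := fun w : ((Fin m → S) × T) × S => (w.1.1, w.2)) (by fun_prop)) (by fun_prop)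
  exact this.integral_prod_right'

lemma stronglyMeasurable_forgetLast {f : (Fin m → S) × T → B} (hf : StronglyMeasurable f) :
    StronglyMeasurable (forgetLast f) :=
  hf.comp_measurable <| Measurable.prodMk (by unfold initArg; fun_prop) (by fun_prop)

lemma stronglyMeasurable_centreLast {h : (Fin (m + 1) → S) × T → B} (hh : StronglyMeasurable h) :
    StronglyMeasurable (centreLast P h) :=
  hh.sub (stronglyMeasurable_forgetLast (stronglyMeasurable_meanLast hh))

/-- The `p`-th moment of the kernel given the arguments in `J`. -/
noncomputable def partPow (p : ℝ) (P : Measure S) (τ : Measure T) (h : (Fin m → S) × T → B)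
    (J : Finset (Fin m)) (x : Fin m → S) : ℝ≥0∞ :=
  ∫⁻ y, npow p τ (fun t => h (J.piecewise x y, t)) ∂(iidLaw (Fin m) P)

lemma measurable_piecewise (J : Finset (Fin m)) :
    Measurable fun w : (Fin m → S) × (Fin m → S) => J.piecewise w.1 w.2 := by
  refine measurable_pi_iff.2 fun i => ?_
  by_cases hi : i ∈ J <;> simp only [hi, Finset.piecewise, if_true, if_false] <;> fun_prop

lemma stronglyMeasurable_piecewise {h : (Fin m → S) × T → B} (hh : StronglyMeasurable h)
    (J : Finset (Fin m)) : StronglyMeasurable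
      fun w : ((Fin m → S) × (Fin m → S)) × T => h (J.piecewise w.1.1 w.1.2, w.2) :=
  hh.comp_measurable <| ((measurable_piecewise J).comp measurable_fst).prodMk measurable_snd

lemma measurable_partPow {h : (Fin m → S) × T → B} (hh : StronglyMeasurable h)
    (J : Finset (Fin m)) : Measurable (partPow p P τ h J) :=
  (measurable_npow (stronglyMeasurable_piecewise hh J)).lintegral_prod_right'

lemma piecewise_map_castSucc (J : Finset (Fin m)) (z : Fin (m + 1) → S) (y : Fin m → S) (s : S) :
    (J.map Fin.castSuccEmb).piecewise z (snocArg y s) = snocArg (J.piecewise (initArg z) y) s := by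
  ext l
  refine Fin.lastCases ?_ (fun l => ?_) l
  · simp [Finset.piecewise, Fin.castSucc_ne_last]
  · by_cases hl : l ∈ J <;> simp [Finset.piecewise, hl, initArg]

lemma piecewise_insert_last (J : Finset (Fin m)) (z : Fin (m + 1) → S) (y : Fin m → S) (s : S) :
    (insert (Fin.last m) (J.map Fin.castSuccEmb)).piecewise z (snocArg y s)
      = snocArg (J.piecewise (initArg z) y) (z (Fin.last m)) := by
  ext l
  refine Fin.lastCases ?_ (fun l => ?_) l
  · simp [Finset.piecewise]
  · by_cases hl : l ∈ J <;> simp [Finset.piecewise, hl, initArg, Fin.castSucc_ne_last]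

lemma lintegral_snocArg {F : (Fin (m + 1) → S) → ℝ≥0∞} (hF : Measurable F) :
    ∫⁻ z, F z ∂(iidLaw (Fin (m + 1)) P)
      = ∫⁻ y, ∫⁻ s, F (snocArg y s) ∂P ∂(iidLaw (Fin m) P) := by
  rw [← (measurePreserving_snocArg P m).lintegral_comp hF]
  exact lintegral_prod (fun z : (Fin m → S) × S => F (snocArg z.1 z.2))
    (hF.comp (measurePreserving_snocArg P m).measurable).aemeasurable

lemma measurable_npow_piecewise {h : (Fin m → S) × T → B} (hh : StronglyMeasurable h)
    (J : Finset (Fin m)) (x : Fin m → S) :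
    Measurable fun y => npow p τ fun t => h (J.piecewise x y, t) :=
  (measurable_npow (stronglyMeasurable_piecewise hh J)).comp (measurable_prodMk_left (x := x))

lemma partPow_map_castSucc {h : (Fin (m + 1) → S) × T → B} (hh : StronglyMeasurable h)
    (J : Finset (Fin m)) (z : Fin (m + 1) → S) :
    partPow p P τ h (J.map Fin.castSuccEmb) z = ∫⁻ y, ∫⁻ s,
      npow p τ (fun t => h (snocArg (J.piecewise (initArg z) y) s, t)) ∂P ∂(iidLaw (Fin m) P) := by
  rw [partPow, lintegral_snocArg (measurable_npow_piecewise hh _ z)]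
  simp_rw [piecewise_map_castSucc]

/-- A frozen argument is one that is conditioned on, so the last index joins the set. An argument
turned into a parameter is averaged instead, and stays outside it (`partPow_addParam`). -/
lemma partPow_fixLast {h : (Fin (m + 1) → S) × T → B} (hh : StronglyMeasurable h)
    (J : Finset (Fin m)) (x : Fin m → S) (s : S) :
    partPow p P τ (fixLast h s) J x
      = partPow p P τ h (insert (Fin.last m) (J.map Fin.castSuccEmb)) (snocArg x s) := by
  conv_rhs => rw [partPow, lintegral_snocArg (measurable_npow_piecewise hh _ (snocArg x s))]
  simp_rw [piecewise_insert_last]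
  simp [partPow, fixLast]

lemma partPow_addParam {h : (Fin (m + 1) → S) × T → B} (hh : StronglyMeasurable h)
    (J : Finset (Fin m)) (z : Fin (m + 1) → S) :
    partPow p P (P.prod τ) (addParam h) J (initArg z)
      = partPow p P τ h (J.map Fin.castSuccEmb) z := by
  rw [partPow_map_castSucc hh, partPow]
  refine lintegral_congr fun y => ?_
  have hm : StronglyMeasurable fun u : S × T => addParam h (J.piecewise (initArg z) y, u) :=
    (stronglyMeasurable_addParam hh).comp_measurable measurable_prodMk_left
  exact (lintegral_npow hm).symm

lemma partPow_meanLast_le (hp : 1 ≤ p) {h : (Fin (m + 1) → S) × T → B} (hh : StronglyMeasurable h)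
    (J : Finset (Fin m)) (z : Fin (m + 1) → S) :
    partPow p P τ (meanLast P h) J (initArg z) ≤ partPow p P τ h (J.map Fin.castSuccEmb) z := by
  rw [partPow_map_castSucc hh, partPow]
  refine lintegral_mono fun y => ?_
  have hm : StronglyMeasurable fun u : S × T => h (snocArg (J.piecewise (initArg z) y) u.1, u.2) :=
    (stronglyMeasurable_addParam hh).comp_measurable measurable_prodMk_left
  have hsw : ∫⁻ s, npow p τ (fun t => h (snocArg (J.piecewise (initArg z) y) s, t)) ∂P
      = ∫⁻ t, ∫⁻ s, ‖h (snocArg (J.piecewise (initArg z) y) s, t)‖ₑ ^ p ∂P ∂τ :=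
    lintegral_lintegral_swap (hm.enorm.pow_const p).aemeasurable
  rw [hsw]
  refine lintegral_mono fun t => ?_
  exact enorm_integral_rpow_le hp (hm.comp_measurable measurable_prodMk_right).aestronglyMeasurable

lemma partPow_forgetLast {f : (Fin m → S) × T → B} (hf : StronglyMeasurable f)
    (J : Finset (Fin (m + 1))) (z : Fin (m + 1) → S) :
    partPow p P τ (forgetLast f) J z
      = partPow p P τ f (Finset.univ.filter fun l => l.castSucc ∈ J) (initArg z) := by
  rw [partPow, partPow, ← (measurePreserving_initArg (P := P)).lintegral_comp
    (measurable_npow_piecewise hf _ (initArg z))]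
  refine lintegral_congr fun y => ?_
  unfold forgetLast
  congr 1
  ext t
  congr 2
  ext l
  simp [initArg, Finset.piecewise]

/-- The mean part ignores the last argument, so Jensen bounds its moment by that of `h` given `J`
without the last index. Which set `J'` occurs does not matter later, since `sumTail` runs over all
of them. -/
lemma partPow_centreLast_le (hp : 1 ≤ p) (hp2 : p ≤ 2) {h : (Fin (m + 1) → S) × T → B}
    (hh : StronglyMeasurable h) (J : Finset (Fin (m + 1))) : ∃ J' : Finset (Fin (m + 1)),
    ∀ z, partPow p P τ (centreLast P h) J z
      ≤ 2 * (partPow p P τ h J z + partPow p P τ h J' z) := by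
  refine ⟨(Finset.univ.filter fun l : Fin m => l.castSucc ∈ J).map Fin.castSuccEmb, fun z => ?_⟩
  have hmean := stronglyMeasurable_meanLast (P := P) hh
  calc partPow p P τ (centreLast P h) J z
      ≤ 2 * (partPow p P τ h J z + partPow p P τ (forgetLast (meanLast P h)) J z) := by
        unfold partPow
        rw [← lintegral_add_left (measurable_npow_piecewise hh J z),
          ← lintegral_const_mul' _ _ (by simp)]
        refine lintegral_mono fun y => npow_le_of_enorm_le hp hp2
          (hh.comp_measurable measurable_prodMk_left).aestronglyMeasurable fun t => ?_
        exact enorm_sub_le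
    _ ≤ _ := by
        gcongr
        rw [partPow_forgetLast hmean]
        exact partPow_meanLast_le hp hh _ z

/-- The sum of the weighted tails of all the conditional `p`-th moments of the kernel. -/
noncomputable def sumTail (p q : ℝ) (P : Measure S) (τ : Measure T) (h : (Fin m → S) × T → B)
    (s : ℝ) : ℝ≥0∞ :=
  ∑ J : Finset (Fin m), tailInt p q (iidLaw (Fin m) P) (partPow p P τ h J) s

lemma tailInt_le_sumTail (h : (Fin m → S) × T → B) (J : Finset (Fin m)) :
    tailInt p q (iidLaw (Fin m) P) (partPow p P τ h J) s ≤ sumTail p q P τ h s :=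
  Finset.single_le_sum (f := fun J => tailInt p q (iidLaw (Fin m) P) (partPow p P τ h J) s)
    (fun _ _ => zero_le) (Finset.mem_univ J)

lemma sumTail_antitone (h : (Fin m → S) × T → B) {s' : ℝ} (hs : s ≤ s') :
    sumTail p q P τ h s' ≤ sumTail p q P τ h s :=
  Finset.sum_le_sum fun _ _ => tailInt_antitone _ hs

lemma sum_finset_le_of_forall_le {f : Finset (Fin m) → ℝ≥0∞} {c : ℝ≥0∞} (h : ∀ J, f J ≤ c) :
    ∑ J, f J ≤ 2 ^ m * c :=
  (Finset.sum_le_card_nsmul _ _ c fun J _ => h J).trans (by simp)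

lemma sumTail_addParam_le {h : (Fin (m + 1) → S) × T → B} (hh : StronglyMeasurable h) :
    sumTail p q P (P.prod τ) (addParam h) s ≤ 2 ^ m * sumTail p q P τ h s :=
  sum_finset_le_of_forall_le fun J => by
    rw [← tailInt_measurePreserving measurePreserving_initArg
      (measurable_partPow (stronglyMeasurable_addParam hh) J)]
    simp_rw [partPow_addParam hh]
    exact tailInt_le_sumTail _ _

lemma sumTail_meanLast_le (hp : 1 ≤ p) {h : (Fin (m + 1) → S) × T → B}
    (hh : StronglyMeasurable h) :
    sumTail p q P τ (meanLast P h) s ≤ 2 ^ m * sumTail p q P τ h s :=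
  sum_finset_le_of_forall_le fun J => by
    rw [← tailInt_measurePreserving measurePreserving_initArg
      (measurable_partPow (stronglyMeasurable_meanLast hh) J)]
    exact (tailInt_mono fun z => partPow_meanLast_le hp hh J z).trans (tailInt_le_sumTail _ _)

lemma measurable_tailInt_right {α β : Type*} [MeasurableSpace α] [MeasurableSpace β]
    {μ : Measure α} [SFinite μ] {X : α × β → ℝ≥0∞} (hX : Measurable X) :
    Measurable fun b => tailInt p q μ (fun a => X (a, b)) s := by
  have hS : MeasurableSet {w : (β × ℝ) × α | ENNReal.ofReal (s * w.1.2 ^ p) < X (w.2, w.1.1)} :=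
    measurableSet_lt (by fun_prop) (by fun_prop)
  have hm : Measurable fun z : β × ℝ => μ {a | ENNReal.ofReal (s * z.2 ^ p) < X (a, z.1)} :=
    measurable_measure_prodMk_left hS
  have hw : Measurable fun z : β × ℝ => ENNReal.ofReal (z.2 ^ (q - 1)) := by fun_prop
  exact (hw.mul hm).lintegral_prod_right'

lemma measurable_partPow_fixLast {h : (Fin (m + 1) → S) × T → B} (hh : StronglyMeasurable h)
    (J : Finset (Fin m)) :
    Measurable fun w : (Fin m → S) × S => partPow p P τ (fixLast h w.2) J w.1 := by
  simp_rw [partPow_fixLast hh]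
  exact (measurable_partPow hh _).comp measurable_snocArg

lemma measurable_sumTail_fixLast {h : (Fin (m + 1) → S) × T → B} (hh : StronglyMeasurable h) :
    Measurable fun y => sumTail p q P τ (fixLast h y) s :=
  Finset.measurable_fun_sum _ fun J _ => measurable_tailInt_right (measurable_partPow_fixLast hh J)

lemma lintegral_sumTail_fixLast_le {h : (Fin (m + 1) → S) × T → B} (hh : StronglyMeasurable h) :
    ∫⁻ y, sumTail p q P τ (fixLast h y) s ∂P ≤ 2 ^ m * sumTail p q P τ h s := by
  unfold sumTail
  rw [lintegral_finsetSum _ fun J _ => measurable_tailInt_right (measurable_partPow_fixLast hh J)]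
  refine sum_finset_le_of_forall_le fun J => ?_
  have h1 := tailInt_prod (p := p) (q := q) (s := s) (μ := iidLaw (Fin m) P) (ν := P)
    (measurable_partPow_fixLast (p := p) (P := P) (τ := τ) hh J)
  rw [← h1]
  simp_rw [partPow_fixLast hh]
  rw [tailInt_measurePreserving (measurePreserving_snocArg P m) (measurable_partPow hh _)]
  exact tailInt_le_sumTail _ _

lemma sumTail_centreLast_le (hp : 1 ≤ p) (hp2 : p ≤ 2) {h : (Fin (m + 1) → S) × T → B}
    (hh : StronglyMeasurable h) : sumTail p q P τ (centreLast P h) s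
      ≤ 2 ^ (m + 1) * (ENNReal.ofReal ((1 / 4 : ℝ) ^ (-(q / p))) * 2) * sumTail p q P τ h s := by
  have hp0 : 0 < p := by linarith
  rw [mul_assoc]
  refine sum_finset_le_of_forall_le fun J => ?_
  obtain ⟨J', hJ'⟩ := partPow_centreLast_le (P := P) (τ := τ) hp hp2 hh J
  have key : ∀ J : Finset (Fin (m + 1)), tailInt p q (iidLaw (Fin (m + 1)) P)
      (fun z => 2 * partPow p P τ h J z) (s / 2)
      ≤ ENNReal.ofReal ((1 / 4 : ℝ) ^ (-(q / p))) * sumTail p q P τ h s := by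
    intro J
    -- One factor `2` comes from sharing the threshold between two summands, the other from the
    -- coefficient of the moments.
    have e : s / 2 = 2 * (1 / 4 * s) := by ring
    rw [e, show (2 : ℝ≥0∞) = ENNReal.ofReal 2 by simp, tailInt_const_mul _ (by norm_num)]
    refine (tailInt_mul_le hp0 (by norm_num) (by norm_num) _).trans ?_
    gcongr
    exact tailInt_le_sumTail _ _
  calc _ ≤ tailInt p q (iidLaw (Fin (m + 1)) P)
        (fun z => 2 * partPow p P τ h J z + 2 * partPow p P τ h J' z) s :=
        tailInt_mono fun z => (hJ' z).trans (by rw [mul_add])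
    _ ≤ _ := tailInt_add_le
    _ ≤ _ := add_le_add (key J) (key J')
    _ = _ := by ring

end kernels

/-! ### Degeneracy under the operations on the last argument. -/

section degenerate

lemma measurePreserving_prod_right_comm {α β γ δ : Type*} [MeasurableSpace α] [MeasurableSpace β]
    [MeasurableSpace γ] [MeasurableSpace δ] {μ : Measure α} {ν : Measure β} {ρ : Measure γ}
    {τ : Measure δ} [SFinite μ] [SFinite ν] [SFinite ρ] [SFinite τ] {g : α × β → γ}
    (hg : MeasurePreserving g (μ.prod ν) ρ) :
    MeasurePreserving (fun w : (α × δ) × β => (g (w.1.1, w.2), w.1.2))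
      ((μ.prod τ).prod ν) (ρ.prod τ) :=
  (hg.prod (MeasurePreserving.id τ)).comp <| (measurePreserving_prodAssoc μ ν τ).symm.comp <|
    ((MeasurePreserving.id μ).prod (Measure.measurePreserving_swap (μ := τ) (ν := ν))).comp <|
      measurePreserving_prodAssoc μ τ ν

variable {B S T : Type*} [NormedAddCommGroup B] [NormedSpace ℝ B] {m d : ℕ}
  [MeasurableSpace S] [MeasurableSpace T] {P : Measure S} [IsProbabilityMeasure P]
  {τ : Measure T} [IsProbabilityMeasure τ]

/-- The conditional expectations of the kernel given less than `d` arguments vanish. -/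
def IsDeg (P : Measure S) (τ : Measure T) (h : (Fin m → S) × T → B) (d : ℕ) : Prop :=
  ∀ I : Finset (Fin m), I.card < d → ∀ᵐ z ∂((iidLaw (Fin m) P).prod τ),
    ∫ y, h (I.piecewise z.1 y, z.2) ∂(iidLaw (Fin m) P) = 0

lemma IsDeg.zero (h : (Fin m → S) × T → B) : IsDeg P τ h 0 :=
  fun _ hI => absurd hI (Nat.not_lt_zero _)

lemma measurePreserving_snocParam :
    MeasurePreserving (fun w : ((Fin m → S) × T) × S => (snocArg w.1.1 w.2, w.1.2))
      (((iidLaw (Fin m) P).prod τ).prod P) ((iidLaw (Fin (m + 1)) P).prod τ) :=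
  measurePreserving_prod_right_comm (measurePreserving_snocArg P m)

lemma ae_integrable_piecewise {h : (Fin m → S) × T → B}
    (hi : Integrable h ((iidLaw (Fin m) P).prod τ)) (J : Finset (Fin m)) :
    ∀ᵐ z ∂((iidLaw (Fin m) P).prod τ),
      Integrable (fun y => h (J.piecewise z.1 y, z.2)) (iidLaw (Fin m) P) := by
  have hmp := measurePreserving_prod_right_comm (τ := τ) (measurePreserving_piecewise P J)
  exact ((hmp.integrable_comp hi.1).2 hi).prod_right_ae

lemma ae_integrable_snocArg {h : (Fin (m + 1) → S) × T → B}
    (hi : Integrable h ((iidLaw (Fin (m + 1)) P).prod τ)) :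
    ∀ᵐ z ∂((iidLaw (Fin m) P).prod τ), Integrable (fun s => h (snocArg z.1 s, z.2)) P :=
  ((measurePreserving_snocParam.integrable_comp hi.1).2 hi).prod_right_ae

lemma integrable_addParam {h : (Fin (m + 1) → S) × T → B}
    (hi : Integrable h ((iidLaw (Fin (m + 1)) P).prod τ)) :
    Integrable (addParam h) ((iidLaw (Fin m) P).prod (P.prod τ)) :=
  (measurePreserving_addParam.integrable_comp hi.1).2 hi

lemma integrable_meanLast {h : (Fin (m + 1) → S) × T → B}
    (hi : Integrable h ((iidLaw (Fin (m + 1)) P).prod τ)) :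
    Integrable (meanLast P h) ((iidLaw (Fin m) P).prod τ) :=
  ((measurePreserving_snocParam.integrable_comp hi.1).2 hi).integral_prod_left

lemma integrable_centreLast {h : (Fin (m + 1) → S) × T → B}
    (hi : Integrable h ((iidLaw (Fin (m + 1)) P).prod τ)) :
    Integrable (centreLast P h) ((iidLaw (Fin (m + 1)) P).prod τ) :=
  hi.sub <| ((measurePreserving_initArg.prod (MeasurePreserving.id τ)).integrable_comp
    (integrable_meanLast hi).1).2 (integrable_meanLast hi)

lemma centreLast_snocArg (h : (Fin (m + 1) → S) × T → B) (x : Fin m → S) (s : S) (t : T) :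
    centreLast P h (snocArg x s, t) = h (snocArg x s, t) - meanLast P h (x, t) := by
  simp [centreLast, forgetLast]

lemma integral_centreLast_snocArg [CompleteSpace B] {h : (Fin (m + 1) → S) × T → B}
    (hi : Integrable h ((iidLaw (Fin (m + 1)) P).prod τ)) :
    ∀ᵐ z ∂((iidLaw (Fin m) P).prod τ), ∫ s, centreLast P h (snocArg z.1 s, z.2) ∂P = 0 := by
  filter_upwards [ae_integrable_snocArg hi] with z hz
  simp_rw [centreLast_snocArg]
  rw [integral_sub hz (integrable_const _)]
  simp [meanLast]

lemma integral_snocArg {F : (Fin (m + 1) → S) → B} (hF : Integrable F (iidLaw (Fin (m + 1)) P)) :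
    ∫ z, F z ∂(iidLaw (Fin (m + 1)) P)
      = ∫ y, ∫ s, F (snocArg y s) ∂P ∂(iidLaw (Fin m) P) := by
  have hmp := measurePreserving_snocArg P m
  conv_lhs => rw [← hmp.map_eq]
  rw [integral_map hmp.measurable.aemeasurable (by rw [hmp.map_eq]; exact hF.1)]
  exact integral_prod (fun z : (Fin m → S) × S => F (snocArg z.1 z.2))
    ((hmp.integrable_comp hF.1).2 hF)

lemma IsDeg.meanLast {h : (Fin (m + 1) → S) × T → B}
    (hi : Integrable h ((iidLaw (Fin (m + 1)) P).prod τ)) (hd : IsDeg P τ h d) :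
    IsDeg P τ (meanLast P h) d := by
  intro I hI
  have h1 := measurePreserving_snocParam.quasiMeasurePreserving.ae
    ((hd (I.map Fin.castSuccEmb) (by simpa using hI)).and
      (ae_integrable_piecewise hi (I.map Fin.castSuccEmb)))
  filter_upwards [Measure.ae_ae_of_ae_prod h1] with z hz
  -- The last index is not conditioned on, so `s` is a dummy and one good value suffices.
  obtain ⟨s, hs0, hsi⟩ := hz.exists
  rw [integral_snocArg hsi] at hs0
  simp_rw [piecewise_map_castSucc, initArg_snocArg] at hs0
  exact hs0

/-- The last argument now counts as known, and conditioning on fewer than `d` others means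
conditioning on fewer than `d + 1` in total. So the contribution of `h` vanishes; that of its mean
vanishes too, as averaging keeps the order. -/
lemma IsDeg.addParam_centreLast {h : (Fin (m + 1) → S) × T → B} (hh : StronglyMeasurable h)
    (hi : Integrable h ((iidLaw (Fin (m + 1)) P).prod τ)) (hd : IsDeg P τ h (d + 1)) :
    IsDeg P (P.prod τ) (addParam (centreLast P h)) d := by
  intro I hI
  set J := insert (Fin.last m) (I.map Fin.castSuccEmb) with hJ
  have hcard : J.card < d + 1 :=
    (Finset.card_insert_le _ _).trans_lt (by simpa using hI)
  have h1 := measurePreserving_addParam.quasiMeasurePreserving.ae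
    ((hd J hcard).and (ae_integrable_piecewise hi J))
  have h2 := ((MeasurePreserving.id (iidLaw (Fin m) P)).prod
    (measurePreserving_snd (μ := P) (ν := τ))).quasiMeasurePreserving.ae
    ((hd.meanLast hi I (by omega)).and (ae_integrable_piecewise (integrable_meanLast hi) I))
  filter_upwards [h1, h2] with w hw1 hw2
  set f : (Fin m → S) → B := fun y => h (snocArg (I.piecewise w.1 y) w.2.1, w.2.2)
  have e : ∀ y, h (J.piecewise (snocArg w.1 w.2.1) y, w.2.2) = f (initArg y) := fun y => by
    conv_lhs => rw [← snocArg_castSucc_last y]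
    rw [hJ, piecewise_insert_last, initArg_snocArg, snocArg_last]
    rfl
  simp_rw [e] at hw1
  simp only [Prod.map_fst, Prod.map_snd, id] at hw2
  have hmp := measurePreserving_initArg (P := P) (m := m)
  have hf : StronglyMeasurable f := (stronglyMeasurable_addParam hh).comp_measurable
    (((measurable_piecewise I).comp (measurable_prodMk_left (x := w.1))).prodMk
      (measurable_const (a := w.2)))
  have hfi : Integrable f (iidLaw (Fin m) P) :=
    (hmp.integrable_comp hf.aestronglyMeasurable).1 hw1.2
  have hf0 : ∫ y, f y ∂(iidLaw (Fin m) P) = 0 := by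
    rw [← hw1.1]
    conv_lhs => rw [← hmp.map_eq]
    exact integral_map hmp.measurable.aemeasurable hf.aestronglyMeasurable
  simp only [addParam, centreLast_snocArg]
  rw [integral_sub hfi hw2.2, hf0, hw2.1, sub_zero]

lemma IsDeg.ae_fixLast {h : (Fin (m + 1) → S) × T → B} (hd : IsDeg P (P.prod τ) (addParam h) d) :
    ∀ᵐ s ∂P, IsDeg P τ (fixLast h s) d := by
  have h1 : ∀ I : Finset (Fin m), ∀ᵐ s ∂P, I.card < d → ∀ᵐ z ∂((iidLaw (Fin m) P).prod τ),
      ∫ y, fixLast h s (I.piecewise z.1 y, z.2) ∂(iidLaw (Fin m) P) = 0 := by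
    intro I
    by_cases hI : I.card < d
    · have := (measurePreserving_prod_left_comm (iidLaw (Fin m) P) P τ).quasiMeasurePreserving.ae
        (hd I hI)
      filter_upwards [Measure.ae_ae_of_ae_prod this] with s hs _ using hs
    · exact Filter.Eventually.of_forall fun s h => absurd h hI
  filter_upwards [ae_all_iff.2 h1] with s hs using hs

lemma ae_integrable_fixLast {h : (Fin (m + 1) → S) × T → B}
    (hi : Integrable h ((iidLaw (Fin (m + 1)) P).prod τ)) :
    ∀ᵐ s ∂P, Integrable (fixLast h s) ((iidLaw (Fin m) P).prod τ) := by
  have hmp := measurePreserving_prod_left_comm (iidLaw (Fin m) P) P τ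
  exact ((hmp.integrable_comp (integrable_addParam hi).1).2 (integrable_addParam hi)).prod_right_ae

/-- The increments of the `U`-statistic, centred given the past. -/
noncomputable def uIncrement (P : Measure S) (h : (Fin (m + 1) → S) × T → B) (k : ℕ)
    (z : (ℕ → S) × T) : B := uSum (addParam (centreLast P h)) k (z.1, (z.1 k, z.2))

lemma addParam_eq_centreLast_add (h : (Fin (m + 1) → S) × T → B) (k : ℕ) (z : (ℕ → S) × T) :
    uSum (addParam h) k (z.1, (z.1 k, z.2))
      = uIncrement P h k z + uSum (meanLast P h) k z := by
  unfold uIncrement uSum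
  rw [← Finset.sum_add_distrib]
  refine Finset.sum_congr rfl fun i _ => ?_
  simp [addParam, centreLast_snocArg]

lemma uIncrement_update (h : (Fin (m + 1) → S) × T → B) (k : ℕ) (x : ℕ → S) (y : S) (t : T) :
    uIncrement P h k (Function.update x k y, t)
      = uSum (addParam (centreLast P h)) k (x, (y, t)) := by
  simp [uIncrement, uSum_update le_rfl]

lemma isMartDiff_uIncrement [CompleteSpace B] {h : (Fin (m + 1) → S) × T → B}
    (hh : StronglyMeasurable h) (hi : Integrable h ((iidLaw (Fin (m + 1)) P).prod τ)) :
    IsMartDiff P τ (uIncrement P h) where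
  stronglyMeasurable k :=
    (stronglyMeasurable_uSum (stronglyMeasurable_addParam (stronglyMeasurable_centreLast hh))
      k).comp_measurable (by fun_prop)
  adapted k l hkl x y t := by
    simp only [uIncrement, uSum_update hkl.le, Function.update_of_ne hkl.ne]
  integrable k := by
    have h1 : ∀ i ∈ incTuples m k, ∀ᵐ z ∂((iidLaw ℕ P).prod τ), Integrable
        (fun s => centreLast P h (snocArg (fun l => z.1 (i l)) s, z.2)) P := fun i hi' =>
      (measurePreserving_incTuple hi').quasiMeasurePreserving.ae
        (ae_integrable_snocArg (integrable_centreLast hi))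
    filter_upwards [(Filter.eventually_all_finset _).2 h1] with z hz
    simp_rw [uIncrement_update]
    exact integrable_finsetSum _ fun i hi' => hz i hi'
  integral_eq_zero k := by
    have h1 : ∀ i ∈ incTuples m k, ∀ᵐ z ∂((iidLaw ℕ P).prod τ), Integrable
        (fun s => centreLast P h (snocArg (fun l => z.1 (i l)) s, z.2)) P := fun i hi' =>
      (measurePreserving_incTuple hi').quasiMeasurePreserving.ae
        (ae_integrable_snocArg (integrable_centreLast hi))
    have h2 : ∀ i ∈ incTuples m k, ∀ᵐ z ∂((iidLaw ℕ P).prod τ),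
        ∫ s, centreLast P h (snocArg (fun l => z.1 (i l)) s, z.2) ∂P = 0 := fun i hi' =>
      (measurePreserving_incTuple hi').quasiMeasurePreserving.ae
        (integral_centreLast_snocArg hi)
    filter_upwards [(Filter.eventually_all_finset _).2 h1,
      (Filter.eventually_all_finset _).2 h2] with z hz hz0
    simp_rw [uIncrement_update]
    unfold uSum addParam
    rw [integral_finsetSum _ fun i hi' => hz i hi']
    exact Finset.sum_eq_zero fun i hi' => hz0 i hi'

end degenerate

/-! ### Exponents, the statement of the induction and its base case. -/

section induction

/-- The exponent of the sample size in the threshold of the `j`-th term of the bound. -/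
noncomputable def tailExp (p : ℝ) (d j : ℕ) : ℝ := ((max d j : ℕ) - (d : ℝ)) * (p - 1) + j

/-- This and `tailExp_zero_succ` match the shift `j ↦ j + 1` caused by the union bound over the
increments: it costs `N` when the order drops by one and `N ^ p` when the order is already zero. -/
lemma tailExp_succ_succ (p : ℝ) (d j : ℕ) : tailExp p (d + 1) (j + 1) = 1 + tailExp p d j := by
  unfold tailExp
  rw [Nat.add_max_add_right]
  push_cast
  ring

lemma tailExp_zero_succ (p : ℝ) (j : ℕ) : tailExp p 0 (j + 1) = p + tailExp p 0 j := by
  unfold tailExp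
  simp only [Nat.zero_max]
  push_cast
  ring

lemma tailExp_antitone {p : ℝ} (hp : 1 ≤ p) {d d' : ℕ} (h : d' ≤ d) (j : ℕ) :
    tailExp p d j ≤ tailExp p d' j := by
  unfold tailExp
  have : ((max d j : ℕ) - (d : ℝ)) ≤ ((max d' j : ℕ) - (d' : ℝ)) := by
    rw [sub_le_sub_iff]
    have : max d j + d' ≤ max d' j + d := by omega
    exact_mod_cast this
  have := mul_le_mul_of_nonneg_right this (sub_nonneg.2 hp)
  linarith

variable {B S T : Type*} [NormedAddCommGroup B] {m d N : ℕ}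
  [MeasurableSpace S] [MeasurableSpace T] {P : Measure S} [IsProbabilityMeasure P]
  {τ : Measure T} [IsProbabilityMeasure τ] {p q t : ℝ} {K : ℝ≥0∞}

/-- The `p`-th power of the norm of the `U`-statistic. -/
noncomputable def uPow (p : ℝ) (τ : Measure T) (h : (Fin m → S) × T → B) (n : ℕ) (x : ℕ → S) :
    ℝ≥0∞ := npow p τ fun t => uSum h n (x, t)

lemma measurable_uPow {h : (Fin m → S) × T → B} (hh : StronglyMeasurable h) (n : ℕ) :
    Measurable (uPow p τ h n) := measurable_npow (stronglyMeasurable_uSum hh n)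

lemma npow_sum_range_le (hp : 1 < p) {f : ℕ → T → B} (hf : ∀ k, AEStronglyMeasurable (f k) τ)
    {n : ℕ} (hn : n ≤ N) {M : ℝ≥0∞} (hM : ∀ k < n, npow p τ (f k) ≤ M) :
    npow p τ (fun t => ∑ k ∈ Finset.range n, f k t) ≤ ENNReal.ofReal ((N : ℝ) ^ p) * M := by
  have hp0 : 0 < p := by linarith
  have hpow : (n : ℝ≥0∞) ^ (p - 1) * (n * M) = (n : ℝ≥0∞) ^ p * M := by
    rcases Nat.eq_zero_or_pos n with rfl | h0
    · simp [hp0]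
    · rw [← mul_assoc]
      congr 1
      conv_lhs => rw [← ENNReal.rpow_one (n : ℝ≥0∞), ← ENNReal.rpow_mul, one_mul]
      rw [← ENNReal.rpow_add _ _ (by simpa using h0.ne') (by simp), sub_add_cancel]
  calc npow p τ (fun t => ∑ k ∈ Finset.range n, f k t)
      ≤ ∫⁻ t, (n : ℝ≥0∞) ^ (p - 1) * ∑ k ∈ Finset.range n, ‖f k t‖ₑ ^ p ∂τ := by
        refine lintegral_mono fun t => ?_
        refine (ENNReal.rpow_le_rpow (enorm_sum_le _ _) hp0.le).trans ?_
        simpa using ENNReal.rpow_sum_le_const_mul_sum_rpow (Finset.range n)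
          (fun k => ‖f k t‖ₑ) hp.le
    _ = (n : ℝ≥0∞) ^ (p - 1) * ∑ k ∈ Finset.range n, npow p τ (f k) := by
        rw [lintegral_const_mul' _ _ (by finiteness),
          lintegral_finsetSum' _ fun k _ => (hf k).enorm.pow_const p]
        rfl
    _ ≤ (n : ℝ≥0∞) ^ (p - 1) * (n * M) := by
        gcongr
        refine (Finset.sum_le_card_nsmul _ _ M fun k hk => hM k (Finset.mem_range.1 hk)).trans ?_
        simp
    _ = (n : ℝ≥0∞) ^ p * M := hpow
    _ ≤ _ := by
        gcongr
        rw [← ENNReal.ofReal_rpow_of_nonneg (by positivity) hp0.le, ENNReal.ofReal_natCast]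
        gcongr

/-- Tail bound, for kernels with `m` arguments, of the maximum of the `U`-statistics. -/
def HasUTailBound.{u, v} (p q : ℝ) (B : Type v) [NormedAddCommGroup B] [NormedSpace ℝ B] (m : ℕ)
    (K : ℝ≥0∞) : Prop :=
  ∀ (S T : Type u) [MeasurableSpace S] [MeasurableSpace T] (P : Measure S) [IsProbabilityMeasure P]
    (τ : Measure T) [IsProbabilityMeasure τ] (h : (Fin m → S) × T → B), StronglyMeasurable h →
    Integrable h ((iidLaw (Fin m) P).prod τ) → ∀ d : ℕ, IsDeg P τ h d → ∀ N : ℕ, 1 ≤ N →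
    ∀ t : ℝ, 0 < t →
    tailInt p q (iidLaw ℕ P) (fun x => (Finset.range (N + 1)).sup fun n => uPow p τ h n x)
        (t * (N : ℝ) ^ (p * (m - d) + d))
      ≤ K * ∑ j ∈ Finset.range (m + 1),
        (N : ℝ≥0∞) ^ j * sumTail p q P τ h (t * (N : ℝ) ^ tailExp p d j)

variable [NormedSpace ℝ B]

lemma tailInt_zero {α : Type*} [MeasurableSpace α] {μ : Measure α} {s : ℝ} :
    tailInt p q μ (fun _ => 0) s = 0 := by
  simp [tailInt, weightInt]

/-- Without arguments the U-statistic is the kernel itself. If `d ≥ 1`, degeneracy for the empty set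
makes it vanish almost everywhere. Orders larger than the number of arguments do occur, because the
drift keeps `d` while losing an argument. -/
lemma hasUTailBound_zero.{u, v} (hp : 1 < p) {B : Type v} [NormedAddCommGroup B]
    [NormedSpace ℝ B] [CompleteSpace B] : HasUTailBound.{u, v} p q B 0 1 := by
  intro S T _ _ P _ τ _ h hh hi d hd N hN t ht
  have hp0 : 0 < p := by linarith
  have hN0 : (N : ℝ) ≠ 0 := by positivity
  have e : ∀ x : ℕ → S, (Finset.range (N + 1)).sup (fun n => uPow p τ h n x)
      = npow p τ fun t => h (fun l => x l, t) := by
    intro x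
    simp only [uPow, uSum_zero_left]
    exact Finset.sup_const ⟨0, by simp⟩ _
  simp_rw [e]
  rcases Nat.eq_zero_or_pos d with rfl | hd0
  · have hmp := measurePreserving_comp_injective P
      (f := fun l : Fin 0 => (l : ℕ)) Fin.val_injective
    have hX : Measurable fun x : Fin 0 → S => npow p τ fun t => h (x, t) := measurable_npow hh
    rw [tailInt_measurePreserving hmp hX]
    have : partPow p P τ h ∅ = fun x => npow p τ fun t => h (x, t) := funext fun x => by
      have : ∀ y : Fin 0 → S, y = x := fun y => Subsingleton.elim _ _
      simp [partPow, this]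
    simp only [tailExp, Finset.range_one, zero_add, Finset.sum_singleton, pow_zero, one_mul]
    refine le_trans (le_of_eq ?_) (tailInt_le_sumTail h ∅)
    rw [this]
    simp
  · have h0 : ∀ x : ℕ → S, npow p τ (fun t => h (fun l : Fin 0 => x l, t)) = 0 := by
      intro x
      have h1 := hd ∅ (by simpa using hd0)
      have h2 : ∀ᵐ z ∂((iidLaw (Fin 0) P).prod τ), h z = 0 := by
        filter_upwards [h1] with z hz
        have : ∀ y : Fin 0 → S, y = z.1 := fun y => Subsingleton.elim _ _
        simpa [this] using hz
      obtain ⟨y, hy⟩ := (Measure.ae_ae_of_ae_prod h2).exists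
      rw [npow, lintegral_eq_zero_iff' ?_]
      · filter_upwards [hy] with t ht
        have : (fun l : Fin 0 => x l) = y := Subsingleton.elim _ _
        simp [this, ht, hp0]
      · exact ((hh.comp_measurable measurable_prodMk_left).enorm.pow_const p).aemeasurable
    simp_rw [h0, tailInt_zero]
    exact zero_le

lemma incPow_uIncrement (h : (Fin (m + 1) → S) × T → B) (k : ℕ) (x : ℕ → S) :
    IsMartDiff.incPow p τ (uIncrement P h) k x = uPow p τ (fixLast (centreLast P h) (x k)) k x := rfl

lemma varPow_uIncrement {h : (Fin (m + 1) → S) × T → B} (hh : StronglyMeasurable h) (k : ℕ)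
    (x : ℕ → S) : IsMartDiff.varPow p P τ (uIncrement P h) k x
      = uPow p (P.prod τ) (addParam (centreLast P h)) k x := by
  have hm := stronglyMeasurable_uSum (stronglyMeasurable_addParam
    (stronglyMeasurable_centreLast (P := P) hh)) k
  simp only [IsMartDiff.varPow, IsMartDiff.incPow, uIncrement_update]
  exact lintegral_npow (f := fun u : S × T => uSum (addParam (centreLast P h)) k (x, u))
    (hm.comp_measurable measurable_prodMk_left)

/-- Martingale plus drift; the drift is a sum of at most `N` terms, bounded by convexity with the
factor `N ^ p`. -/
lemma uPow_le (hp : 1 < p) (hp2 : p ≤ 2) {h : (Fin (m + 1) → S) × T → B}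
    (hh : StronglyMeasurable h) {n : ℕ} (hn : n ≤ N) (x : ℕ → S) :
    uPow p τ h n x ≤ ENNReal.ofReal 2 * IsMartDiff.sumPow p τ (uIncrement P h) n x
      + ENNReal.ofReal (2 * (N : ℝ) ^ p) *
        (Finset.range (N + 1)).sup fun n => uPow p τ (meanLast P h) n x := by
  have hm1 : ∀ k, StronglyMeasurable (uIncrement P h k : (ℕ → S) × T → B) := fun k =>
    (stronglyMeasurable_uSum (stronglyMeasurable_addParam (stronglyMeasurable_centreLast hh))
      k).comp_measurable (by fun_prop)
  have hm2 := fun k => stronglyMeasurable_uSum (stronglyMeasurable_meanLast (P := P) hh) k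
  calc uPow p τ h n x ≤ 2 * (IsMartDiff.sumPow p τ (uIncrement P h) n x
        + npow p τ fun t => ∑ k ∈ Finset.range n, uSum (meanLast P h) k (x, t)) := by
        refine npow_le_of_enorm_le hp.le hp2 (StronglyMeasurable.aestronglyMeasurable <|
          Finset.stronglyMeasurable_fun_sum _ fun k _ =>
            (hm1 k).comp_measurable measurable_prodMk_left) fun t => ?_
        rw [uSum_eq_sum_range]
        simp_rw [addParam_eq_centreLast_add (P := P) h _ (x, t)]
        rw [Finset.sum_add_distrib]
        exact enorm_add_le _ _
    _ ≤ 2 * (IsMartDiff.sumPow p τ (uIncrement P h) n x + ENNReal.ofReal ((N : ℝ) ^ p) *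
        (Finset.range (N + 1)).sup fun n => uPow p τ (meanLast P h) n x) := by
        gcongr
        refine npow_sum_range_le hp (fun k =>
          ((hm2 k).comp_measurable measurable_prodMk_left).aestronglyMeasurable) hn fun k hk => ?_
        exact Finset.le_sup (f := fun n => uPow p τ (meanLast P h) n x)
          (Finset.mem_range.2 (by omega))
    _ = _ := by
        rw [ENNReal.ofReal_mul (by norm_num), mul_add, mul_assoc]
        simp

lemma sum_range_succ_mono {a b : ℕ → ℝ≥0∞} (h : ∀ j, a j ≤ b j) :
    ∑ j ∈ Finset.range (m + 1), a j ≤ ∑ j ∈ Finset.range (m + 1 + 1), b j :=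
  (Finset.sum_le_sum fun j _ => h j).trans
    (Finset.sum_le_sum_of_subset (Finset.range_subset_range.2 (Nat.le_succ _)))

end induction

/-! ### The induction step: drift, conditional moments and increments. -/

section step

variable {m d N : ℕ} {p q t : ℝ} {K : ℝ≥0∞}

lemma HasUTailBound.drift_le.{u, v} {B : Type v} [NormedAddCommGroup B] [NormedSpace ℝ B]
    (hK : HasUTailBound.{u, v} p q B m K) (hp : 1 < p)
    {S T : Type u} [MeasurableSpace S] [MeasurableSpace T] {P : Measure S} [IsProbabilityMeasure P]
    {τ : Measure T} [IsProbabilityMeasure τ] {h : (Fin (m + 1) → S) × T → B}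
    (hh : StronglyMeasurable h) (hi : Integrable h ((iidLaw (Fin (m + 1)) P).prod τ))
    (hd : IsDeg P τ h d) (hN : 1 ≤ N) (ht : 0 < t) :
    tailInt p q (iidLaw ℕ P)
        (fun x => (Finset.range (N + 1)).sup fun n => uPow p τ (meanLast P h) n x)
        (t * (N : ℝ) ^ (p * (m - d) + d))
      ≤ K * 2 ^ m * ∑ j ∈ Finset.range (m + 1 + 1),
        (N : ℝ≥0∞) ^ j * sumTail p q P τ h (t * (N : ℝ) ^ tailExp p d j) := by
  refine (hK S T P τ _ (stronglyMeasurable_meanLast hh) (integrable_meanLast hi) d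
    (hd.meanLast hi) N hN t ht).trans ?_
  rw [mul_assoc, Finset.mul_sum (a := 2 ^ m)]
  gcongr
  refine sum_range_succ_mono fun j => ?_
  rw [mul_left_comm]
  gcongr
  exact sumTail_meanLast_le hp.le hh

/-- Each of the `N` conditional moments is the power of a U-statistic with parameter in `S × T`, and
is at most their maximum. The induction hypothesis is applied with that larger parameter space and
order `d - 1`. -/
lemma HasUTailBound.var_le.{u, v} {B : Type v} [NormedAddCommGroup B] [NormedSpace ℝ B]
    (hK : HasUTailBound.{u, v} p q B m K) (hp : 1 < p)
    {S T : Type u} [MeasurableSpace S] [MeasurableSpace T] {P : Measure S} [IsProbabilityMeasure P]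
    {τ : Measure T} [IsProbabilityMeasure τ] {h : (Fin (m + 1) → S) × T → B}
    (hh : StronglyMeasurable h) (hi : Integrable h ((iidLaw (Fin (m + 1)) P).prod τ))
    (hd : IsDeg P τ h d) (hN : 1 ≤ N) (ht : 0 < t) :
    tailInt p q (iidLaw ℕ P)
        (fun x => ∑ k ∈ Finset.range N, IsMartDiff.varPow p P τ (uIncrement P h) k x)
        (t * (N : ℝ) ^ (p * (m + 1 - d) + d))
      ≤ K * 2 ^ m * ∑ j ∈ Finset.range (m + 1 + 1),
        (N : ℝ≥0∞) ^ j * sumTail p q P τ (centreLast P h) (t * (N : ℝ) ^ tailExp p d j) := by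
  have hN1 : (1 : ℝ) ≤ N := by exact_mod_cast hN
  have hN0 : (0 : ℝ) < N := by linarith
  have hc := stronglyMeasurable_centreLast (P := P) hh
  have hdeg : IsDeg P (P.prod τ) (addParam (centreLast P h)) (d - 1) := by
    rcases d with _ | d
    · exact IsDeg.zero _
    · exact hd.addParam_centreLast hh hi
  -- An equality for `d ≥ 1`. For `d = 0` the truncated subtraction keeps order `0`, and `1 ≤ p` is
  -- what is used.
  have hexp : p * (m - (d - 1 : ℕ)) + (d - 1 : ℕ) + 1 ≤ p * (m + 1 - d) + d := by
    rcases d with _ | d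
    · simp; nlinarith
    · simp; nlinarith
  set X := fun x => (Finset.range (N + 1)).sup
    fun n => uPow p (P.prod τ) (addParam (centreLast P h)) n x
  calc tailInt p q (iidLaw ℕ P)
        (fun x => ∑ k ∈ Finset.range N, IsMartDiff.varPow p P τ (uIncrement P h) k x)
        (t * (N : ℝ) ^ (p * (m + 1 - d) + d))
      ≤ tailInt p q (iidLaw ℕ P) (fun x => ENNReal.ofReal N * X x)
        (t * (N : ℝ) ^ (p * (m + 1 - d) + d)) := by
        refine tailInt_mono fun x => ?_
        refine (Finset.sum_le_card_nsmul _ _ (X x) fun k hk => ?_).trans (by simp)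
        rw [varPow_uIncrement hh]
        exact Finset.le_sup (f := fun n => uPow p (P.prod τ) (addParam (centreLast P h)) n x)
          (Finset.mem_range.2 (by have := Finset.mem_range.1 hk; omega))
    _ ≤ tailInt p q (iidLaw ℕ P) (fun x => ENNReal.ofReal N * X x)
        (N * (t * (N : ℝ) ^ (p * (m - (d - 1 : ℕ)) + (d - 1 : ℕ)))) := by
        refine tailInt_antitone _ ?_
        calc (N : ℝ) * (t * (N : ℝ) ^ (p * (m - (d - 1 : ℕ)) + (d - 1 : ℕ)))
            = t * (N : ℝ) ^ (p * (m - (d - 1 : ℕ)) + (d - 1 : ℕ) + 1) := by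
              rw [Real.rpow_add_one hN0.ne']; ring
          _ ≤ _ := by gcongr
    _ = tailInt p q (iidLaw ℕ P) X (t * (N : ℝ) ^ (p * (m - (d - 1 : ℕ)) + (d - 1 : ℕ))) :=
        tailInt_const_mul _ hN0
    _ ≤ _ := hK S (S × T) P (P.prod τ) _ (stronglyMeasurable_addParam hc)
        (integrable_addParam (integrable_centreLast hi)) (d - 1) hdeg N hN t ht
    _ ≤ _ := by
        rw [mul_assoc, Finset.mul_sum (a := 2 ^ m)]
        gcongr
        refine sum_range_succ_mono fun j => ?_
        rw [mul_left_comm]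
        gcongr
        refine (sumTail_addParam_le hc).trans ?_
        gcongr
        refine sumTail_antitone _ ?_
        gcongr
        exact tailExp_antitone hp.le (Nat.sub_le _ _) j

lemma HasUTailBound.inc_le.{u, v} {B : Type v} [NormedAddCommGroup B] [NormedSpace ℝ B]
    (hK : HasUTailBound.{u, v} p q B m K)
    {S T : Type u} [MeasurableSpace S] [MeasurableSpace T] {P : Measure S} [IsProbabilityMeasure P]
    {τ : Measure T} [IsProbabilityMeasure τ] {h : (Fin (m + 1) → S) × T → B}
    (hh : StronglyMeasurable h) (hi : Integrable h ((iidLaw (Fin (m + 1)) P).prod τ))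
    (hd : IsDeg P τ h d) (hN : 1 ≤ N) (ht : 0 < t) :
    tailInt p q (iidLaw ℕ P)
        (fun x => (Finset.range N).sup fun k => IsMartDiff.incPow p τ (uIncrement P h) k x)
        (t * (N : ℝ) ^ (p * (m + 1 - d) + d))
      ≤ K * 2 ^ m * ∑ j ∈ Finset.range (m + 1 + 1),
        (N : ℝ≥0∞) ^ j * sumTail p q P τ (centreLast P h) (t * (N : ℝ) ^ tailExp p d j) := by
  have hN1 : (1 : ℝ) ≤ N := by exact_mod_cast hN
  have hN0 : (0 : ℝ) < N := by linarith
  have hc := stronglyMeasurable_centreLast (P := P) hh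
  have hci := integrable_centreLast hi
  have hdeg : IsDeg P (P.prod τ) (addParam (centreLast P h)) (d - 1) := by
    rcases d with _ | d
    · exact IsDeg.zero _
    · exact hd.addParam_centreLast hh hi
  -- `N ^ κ` is the part of the threshold left over by the induction hypothesis: `κ = p` for `d = 0`
  -- and `κ = 1` otherwise. The same `κ` relates the exponents on the right.
  obtain ⟨κ, hκ1, hκ2⟩ : ∃ κ : ℝ,
      p * (m + 1 - d) + d = κ + (p * (m - (d - 1 : ℕ)) + (d - 1 : ℕ)) ∧
      ∀ j, tailExp p d (j + 1) = κ + tailExp p (d - 1) j := by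
    rcases d with _ | d
    · exact ⟨p, by simp; ring, tailExp_zero_succ p⟩
    · exact ⟨1, by simp; ring, fun j => tailExp_succ_succ p d j⟩
  set s := t * (N : ℝ) ^ (p * (m + 1 - d) + d) with hs
  have hterm : ∀ k ∈ Finset.range N, tailInt p q (iidLaw ℕ P)
      (fun x => IsMartDiff.incPow p τ (uIncrement P h) k x) s
      ≤ K * 2 ^ m * ∑ j ∈ Finset.range (m + 1), (N : ℝ≥0∞) ^ j *
        sumTail p q P τ (centreLast P h) (t * (N : ℝ) ^ tailExp p d (j + 1)) := by
    intro k hk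
    have hX : Measurable fun w : (ℕ → S) × S => uPow p τ (fixLast (centreLast P h) w.2) k w.1 := by
      have := stronglyMeasurable_uSum (stronglyMeasurable_addParam hc) k
      exact measurable_npow (f := fun w : ((ℕ → S) × S) × T =>
        uSum (addParam (centreLast P h)) k (w.1.1, (w.1.2, w.2)))
        (this.comp_measurable (by fun_prop))
    have hmp := measurePreserving_update P k
    have hinc : Measurable fun x => IsMartDiff.incPow p τ (uIncrement P h) k x :=
      hX.comp (f := fun x : ℕ → S => (x, x k)) (by fun_prop)
    have e : ∀ w : (ℕ → S) × S,
        IsMartDiff.incPow p τ (uIncrement P h) k (Function.update w.1 k w.2)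
          = uPow p τ (fixLast (centreLast P h) w.2) k w.1 := fun w => by
      simp [incPow_uIncrement, uPow, uSum_update le_rfl]
    -- Coordinate `k` becomes an independent variable `y`; for almost every `y` the induction
    -- hypothesis applies to the kernel frozen at `y`, and the bound is then averaged over `y`.
    rw [← tailInt_measurePreserving hmp hinc]
    simp_rw [e]
    rw [tailInt_prod hX]
    calc ∫⁻ y, tailInt p q (iidLaw ℕ P)
          (fun x => uPow p τ (fixLast (centreLast P h) y) k x) s ∂P
        ≤ ∫⁻ y, K * ∑ j ∈ Finset.range (m + 1), (N : ℝ≥0∞) ^ j * sumTail p q P τ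
          (fixLast (centreLast P h) y) (t * (N : ℝ) ^ κ * (N : ℝ) ^ tailExp p (d - 1) j) ∂P := by
          refine lintegral_mono_ae ?_
          filter_upwards [hdeg.ae_fixLast, ae_integrable_fixLast hci] with y hy1 hy2
          refine le_trans ?_ (hK S T P τ _ (stronglyMeasurable_fixLast hc y) hy2 (d - 1) hy1 N hN
            (t * (N : ℝ) ^ κ) (by positivity))
          rw [mul_assoc, ← Real.rpow_add hN0, ← hκ1]
          refine tailInt_mono fun x => ?_
          exact Finset.le_sup (f := fun n => uPow p τ (fixLast (centreLast P h) y) n x)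
            (Finset.mem_range.2 (by have := Finset.mem_range.1 hk; omega))
      _ = K * ∑ j ∈ Finset.range (m + 1), (N : ℝ≥0∞) ^ j * ∫⁻ y, sumTail p q P τ
          (fixLast (centreLast P h) y) (t * (N : ℝ) ^ tailExp p d (j + 1)) ∂P := by
          have hmeas := fun s => measurable_sumTail_fixLast (p := p) (q := q) (P := P) (τ := τ)
            (s := s) hc
          rw [lintegral_const_mul _ (Finset.measurable_fun_sum _ fun j _ =>
            (hmeas _).const_mul _), lintegral_finsetSum _ fun j _ => (hmeas _).const_mul _]
          congr 1
          refine Finset.sum_congr rfl fun j _ => ?_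
          rw [lintegral_const_mul _ (hmeas _), mul_assoc, ← Real.rpow_add hN0, ← hκ2]
      _ ≤ _ := by
          rw [mul_assoc, Finset.mul_sum (a := 2 ^ m)]
          refine mul_le_mul_right (Finset.sum_le_sum fun j _ => ?_) _
          rw [mul_left_comm]
          gcongr
          exact lintegral_sumTail_fixLast_le hc
  refine (tailInt_sup_le _ _).trans ((Finset.sum_le_card_nsmul _ _ _ hterm).trans ?_)
  -- The factor `N` of the union bound is merged into `N ^ j`, giving the terms of index `j + 1`;
  -- the missing term of index `0` is added for free.
  rw [Finset.card_range, nsmul_eq_mul, mul_left_comm, Finset.mul_sum,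
    Finset.sum_range_succ' _ (m + 1)]
  gcongr
  refine le_trans (le_of_eq ?_) le_self_add
  refine Finset.sum_congr rfl fun j _ => ?_
  rw [pow_succ]; ring

lemma exists_hasUTailBound_succ.{u, v} {B : Type v} [NormedAddCommGroup B] [NormedSpace ℝ B]
    [CompleteSpace B] {C : ℝ≥0∞} (hC : C ≠ ∞) (hB : HasMartingaleType.{u, v} p C B) (hp : 1 < p)
    (hp2 : p ≤ 2) (hq : 0 < q) (hKfin : K ≠ ∞) (hK : HasUTailBound.{u, v} p q B m K) :
    ∃ K' : ℝ≥0∞, K' ≠ ∞ ∧ HasUTailBound.{u, v} p q B (m + 1) K' := by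
  have hp0 : 0 < p := by linarith
  obtain ⟨K₀, hK₀, hgl⟩ := exists_tailInt_sumPow_le.{u, v} hp.le hp2 hq hC
  set c := ENNReal.ofReal ((1 / 4 : ℝ) ^ (-(q / p))) with hcdef
  set D : ℝ≥0∞ := 2 ^ (m + 1) * (c * 2) with hD
  refine ⟨c * (K₀ * (K * 2 ^ m * D + K * 2 ^ m * D)) + c * (K * 2 ^ m), by finiteness, ?_⟩
  intro S T _ _ P _ τ _ h hh hi d hd N hN t ht
  have hN1 : (1 : ℝ) ≤ N := by exact_mod_cast hN
  have hN0 : (0 : ℝ) < N := by linarith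
  set s := t * (N : ℝ) ^ (p * ((m + 1 : ℕ) - d) + d) with hs
  have hs0 : 0 < s := by positivity
  set R := ∑ j ∈ Finset.range (m + 1 + 1),
    (N : ℝ≥0∞) ^ j * sumTail p q P τ h (t * (N : ℝ) ^ tailExp p d j) with hR
  have hRc : ∑ j ∈ Finset.range (m + 1 + 1), (N : ℝ≥0∞) ^ j *
      sumTail p q P τ (centreLast P h) (t * (N : ℝ) ^ tailExp p d j) ≤ D * R := by
    rw [hR, Finset.mul_sum]
    refine Finset.sum_le_sum fun j _ => ?_
    rw [mul_left_comm]
    gcongr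
    exact sumTail_centreLast_le hp.le hp2 hh
  have hscast : s = t * (N : ℝ) ^ (p * (m + 1 - d) + d) := by rw [hs]; push_cast; rfl
  have hmart : tailInt p q (iidLaw ℕ P) (fun x => (Finset.range (N + 1)).sup
      fun n => IsMartDiff.sumPow p τ (uIncrement P h) n x) s
      ≤ K₀ * (K * 2 ^ m * D + K * 2 ^ m * D) * R := by
    refine (hgl B hB S T P τ _ (isMartDiff_uIncrement hh hi) N s hs0).trans ?_
    rw [mul_assoc, add_mul, mul_assoc _ D R]
    rw [hscast]
    gcongr
    · exact (hK.inc_le hh hi hd hN ht).trans (by gcongr)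
    · exact (hK.var_le hp hh hi hd hN ht).trans (by gcongr)
  set X := fun x => (Finset.range (N + 1)).sup
    fun n => IsMartDiff.sumPow p τ (uIncrement P h) n x
  set Y := fun x => (Finset.range (N + 1)).sup fun n => uPow p τ (meanLast P h) n x
  have hY : tailInt p q (iidLaw ℕ P) Y (t * (N : ℝ) ^ (p * (m - d) + d)) ≤ K * 2 ^ m * R :=
    hK.drift_le hp hh hi hd hN ht
  -- The factor `N ^ p` of the drift is exactly the gain in the threshold from `m` to `m + 1`
  -- arguments.
  have hsY : s / 2 = 2 * (N : ℝ) ^ p * (1 / 4 * (t * (N : ℝ) ^ (p * (m - d) + d))) := by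
    rw [hscast, show p * (m + 1 - d : ℝ) + d = p + (p * (m - d) + d) by ring, Real.rpow_add hN0]
    ring
  calc tailInt p q (iidLaw ℕ P) (fun x => (Finset.range (N + 1)).sup fun n => uPow p τ h n x) s
      ≤ tailInt p q (iidLaw ℕ P)
        (fun x => ENNReal.ofReal 2 * X x + ENNReal.ofReal (2 * (N : ℝ) ^ p) * Y x) s := by
        refine tailInt_mono fun x => Finset.sup_le fun n hn => ?_
        refine (uPow_le (P := P) hp hp2 hh (Nat.lt_succ_iff.1 (Finset.mem_range.1 hn)) x).trans ?_
        gcongr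
        exact Finset.le_sup (f := fun n => IsMartDiff.sumPow p τ (uIncrement P h) n x) hn
    _ ≤ _ := tailInt_add_le
    _ = tailInt p q (iidLaw ℕ P) X (1 / 4 * s)
        + tailInt p q (iidLaw ℕ P) Y (1 / 4 * (t * (N : ℝ) ^ (p * (m - d) + d))) := by
        congr 1
        · rw [show s / 2 = 2 * (1 / 4 * s) by ring, tailInt_const_mul _ (by norm_num)]
        · rw [hsY, tailInt_const_mul _ (by positivity)]
    _ ≤ c * (K₀ * (K * 2 ^ m * D + K * 2 ^ m * D) * R) + c * (K * 2 ^ m * R) := by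
        gcongr
        · exact (tailInt_mul_le hp0 (by norm_num) (by norm_num) _).trans (by gcongr)
        · exact (tailInt_mul_le hp0 (by norm_num) (by norm_num) _).trans (by gcongr)
    _ = _ := by ring

lemma exists_hasUTailBound.{u, v} {B : Type v} [NormedAddCommGroup B] [NormedSpace ℝ B]
    [CompleteSpace B] {C : ℝ≥0∞} (hC : C ≠ ∞) (hB : HasMartingaleType.{u, v} p C B) (hp : 1 < p)
    (hp2 : p ≤ 2) (hq : 0 < q) (m : ℕ) :
    ∃ K : ℝ≥0∞, K ≠ ∞ ∧ HasUTailBound.{u, v} p q B m K := by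
  induction m with
  | zero => exact ⟨1, by simp, hasUTailBound_zero hp⟩
  | succ m ih =>
    obtain ⟨K, hK, hKb⟩ := ih
    exact exists_hasUTailBound_succ hC hB hp hp2 hq hK hKb

end step

/-! ### Conditional expectations of functions of the first variables, and symmetry. -/

section conditional

variable {S : Type*} [MeasurableSpace S] {P : Measure S} [IsProbabilityMeasure P] {m : ℕ}

/-- The tuple whose first `k` arguments are those of `x` and whose other ones are those of `y`. -/
def glueFirst {k m : ℕ} (x : Fin k → S) (y : Fin m → S) : Fin m → S :=
  fun i => if h : (i : ℕ) < k then x ⟨i, h⟩ else y i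

lemma measurePreserving_glueFirst (k m : ℕ) :
    MeasurePreserving (fun z : (Fin k → S) × (Fin m → S) => glueFirst z.1 z.2)
      ((iidLaw (Fin k) P).prod (iidLaw (Fin m) P)) (iidLaw (Fin m) P) := by
  have hf : Function.Injective fun i : Fin m =>
      if h : (i : ℕ) < k then (Sum.inl ⟨i, h⟩ : Fin k ⊕ Fin m) else Sum.inr i := by
    intro i j h
    by_cases hi : (i : ℕ) < k <;> by_cases hj : (j : ℕ) < k <;>
      simp_all [Fin.ext_iff]
  convert measurePreserving_glue P hf using 2 with z
  ext i
  by_cases hi : (i : ℕ) < k <;> simp [glueFirst, hi]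

lemma glueFirst_castLE {k : ℕ} (hk : k ≤ m) (x : Fin k → S) (y : Fin m → S) :
    (fun i : Fin k => glueFirst x y (Fin.castLE hk i)) = x := by
  ext i; simp [glueFirst]

lemma measurePreserving_castLE {k : ℕ} (hk : k ≤ m) :
    MeasurePreserving (fun (x : Fin m → S) (i : Fin k) => x (Fin.castLE hk i))
      (iidLaw (Fin m) P) (iidLaw (Fin k) P) :=
  measurePreserving_comp_injective P (Fin.castLE_injective hk)

lemma setLIntegral_castLE {k : ℕ} (hk : k ≤ m) {f : (Fin m → S) → ℝ≥0∞} (hf : Measurable f)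
    {A : Set (Fin k → S)} (hA : MeasurableSet A) :
    ∫⁻ x in (fun (x : Fin m → S) (i : Fin k) => x (Fin.castLE hk i)) ⁻¹' A, f x ∂(iidLaw (Fin m) P)
      = ∫⁻ x in A, ∫⁻ y, f (glueFirst x y) ∂(iidLaw (Fin m) P) ∂(iidLaw (Fin k) P) := by
  have hmp := measurePreserving_glueFirst (P := P) k m
  rw [← hmp.setLIntegral_comp_preimage ((measurePreserving_castLE (P := P) hk).measurable hA) hf]
  have : (fun z : (Fin k → S) × (Fin m → S) => glueFirst z.1 z.2) ⁻¹'
      ((fun (x : Fin m → S) (i : Fin k) => x (Fin.castLE hk i)) ⁻¹' A) = A ×ˢ Set.univ := by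
    ext z
    simp [glueFirst_castLE]
  rw [this, ← Measure.prod_restrict, Measure.restrict_univ]
  exact lintegral_prod (fun z : (Fin k → S) × (Fin m → S) => f (glueFirst z.1 z.2))
    (hf.comp hmp.measurable).aemeasurable

variable {B : Type*} [NormedAddCommGroup B] [NormedSpace ℝ B]

lemma setIntegral_castLE {k : ℕ} (hk : k ≤ m) {f : (Fin m → S) → B} (hf : StronglyMeasurable f)
    (hfi : Integrable f (iidLaw (Fin m) P)) {A : Set (Fin k → S)} (hA : MeasurableSet A) :
    ∫ x in (fun (x : Fin m → S) (i : Fin k) => x (Fin.castLE hk i)) ⁻¹' A, f x ∂(iidLaw (Fin m) P)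
      = ∫ x in A, ∫ y, f (glueFirst x y) ∂(iidLaw (Fin m) P) ∂(iidLaw (Fin k) P) := by
  have hmp := measurePreserving_glueFirst (P := P) k m
  conv_lhs => rw [← hmp.map_eq]
  rw [setIntegral_map ((measurePreserving_castLE (P := P) hk).measurable hA)
    hf.aestronglyMeasurable hmp.measurable.aemeasurable]
  have : (fun z : (Fin k → S) × (Fin m → S) => glueFirst z.1 z.2) ⁻¹'
      ((fun (x : Fin m → S) (i : Fin k) => x (Fin.castLE hk i)) ⁻¹' A) = A ×ˢ Set.univ := by
    ext z
    simp [glueFirst_castLE]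
  rw [this, ← Measure.prod_restrict, Measure.restrict_univ]
  have hi : Integrable (fun z : (Fin k → S) × (Fin m → S) => f (glueFirst z.1 z.2))
      ((iidLaw (Fin k) P).prod (iidLaw (Fin m) P)) :=
    (hmp.integrable_comp hf.aestronglyMeasurable).2 hfi
  refine integral_prod (fun z : (Fin k → S) × (Fin m → S) => f (glueFirst z.1 z.2)) ?_
  have h2 := hi.integrableOn (s := A ×ˢ Set.univ)
  rwa [IntegrableOn, ← Measure.prod_restrict, Measure.restrict_univ] at h2

/-- A permutation which sends the first indices to a given set of indices. -/
lemma exists_perm_mem_iff (I : Finset (Fin m)) :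
    ∃ σ : Equiv.Perm (Fin m), ∀ i, σ i ∈ I ↔ (i : ℕ) < I.card := by
  classical
  have hI : I.card ≤ m := by simpa using I.card_le_univ
  have hcard : Fintype.card {i : Fin m // (i : ℕ) < I.card} = Fintype.card {i // i ∈ I} := by
    rw [Fintype.card_coe, Fintype.card_subtype]
    have : (Finset.univ.filter fun i : Fin m => (i : ℕ) < I.card)
        = (Finset.univ : Finset (Fin I.card)).map (Fin.castLEEmb hI) := by
      ext i
      simp only [Finset.mem_filter, Finset.mem_univ, true_and, Finset.mem_map]
      exact ⟨fun h => ⟨⟨i, h⟩, by ext; simp⟩, by rintro ⟨a, rfl⟩; simp⟩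
    rw [this]; simp
  refine ⟨(Fintype.equivOfCardEq hcard).extendSubtype, fun i => ⟨fun h => ?_, fun h => ?_⟩⟩
  · by_contra hcon
    exact Equiv.extendSubtype_not_mem _ i hcon h
  · exact Equiv.extendSubtype_mem _ i h

/-- A permutation taking the first `I.card` positions to `I` turns conditioning on `I` into
conditioning on initial variables. -/
lemma exists_piecewise_eq_glueFirst {β : Type*} {f : (Fin m → S) → β}
    (hf : ∀ (σ : Equiv.Perm (Fin m)) (x : Fin m → S), f (fun i => x (σ i)) = f x)
    (I : Finset (Fin m)) : ∃ (σ : Equiv.Perm (Fin m)) (hI : I.card ≤ m), ∀ x y,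
      f (I.piecewise x y)
        = f (glueFirst (fun i : Fin I.card => x (σ (Fin.castLE hI i))) fun i => y (σ i)) := by
  obtain ⟨σ, hσ⟩ := exists_perm_mem_iff I
  refine ⟨σ, by simpa using I.card_le_univ, fun x y => ?_⟩
  rw [← hf σ]
  congr 1
  ext i
  by_cases h : (i : ℕ) < I.card
  · simp [glueFirst, Finset.piecewise, hσ, h]
  · simp [glueFirst, Finset.piecewise, hσ, h]

variable {Ω : Type*} [MeasurableSpace Ω] {μ : Measure Ω} [IsProbabilityMeasure μ] {ξ : ℕ → Ω → S}

lemma IsIID.measurePreserving (hξ : IsIID μ ξ) :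
    MeasurePreserving (fun ω i => ξ i ω) μ (iidLaw ℕ (μ.map (ξ 0))) := by
  refine ⟨measurable_pi_iff.2 hξ.measurable, ?_⟩
  rw [hξ.indep.map_fun_eq_infinitePi_map hξ.measurable]
  simp_rw [(hξ.identDistrib _).map_eq]

lemma IsIID.measurePreserving_fin (hξ : IsIID μ ξ) (k : ℕ) :
    MeasurePreserving (fun ω (i : Fin k) => ξ i ω) μ (iidLaw (Fin k) (μ.map (ξ 0))) :=
  haveI := Measure.isProbabilityMeasure_map (μ := μ) (hξ.measurable 0).aemeasurable
  (measurePreserving_comp_injective (μ.map (ξ 0)) Fin.val_injective).comp hξ.measurePreserving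

lemma IsIID.firstSigma_le (hξ : IsIID μ ξ) (k : ℕ) : firstSigma ξ k ≤ ‹MeasurableSpace Ω› :=
  (hξ.measurePreserving_fin k).measurable.comap_le

/-- By independence the remaining variables are integrated out with the known ones frozen. It is
enough to compare integrals over preimages of sets of the first `k` coordinates, where Tonelli
applies. -/
lemma IsIID.condLExp_ae_eq (hξ : IsIID μ ξ) {k : ℕ} (hk : k ≤ m) {f : (Fin m → S) → ℝ≥0∞}
    (hf : Measurable f) :
    (fun ω => ∫⁻ y, f (glueFirst (fun i : Fin k => ξ i ω) y) ∂(iidLaw (Fin m) (μ.map (ξ 0))))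
      =ᵐ[μ] condLExp (firstSigma ξ k) μ fun ω => f fun i => ξ i ω := by
  have := Measure.isProbabilityMeasure_map (hξ.measurable 0).aemeasurable (μ := μ)
  have hmk := hξ.measurePreserving_fin k
  have hmm := hξ.measurePreserving_fin m
  have hG : Measurable fun x : Fin k → S =>
      ∫⁻ y, f (glueFirst x y) ∂(iidLaw (Fin m) (μ.map (ξ 0))) :=
    (hf.comp (measurePreserving_glueFirst (P := μ.map (ξ 0)) k m).measurable).lintegral_prod_right'
  refine ae_eq_condLExp (hm := hξ.firstSigma_le k) μ _ (hG.comp (comap_measurable _)) ?_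
  rintro s ⟨A, hA, rfl⟩
  rw [hmk.setLIntegral_comp_preimage hA hG, ← setLIntegral_castLE hk hf hA,
    ← hmm.setLIntegral_comp_preimage ((measurePreserving_castLE (P := μ.map (ξ 0)) hk).measurable hA)
      hf]
  rfl

lemma IsIID.condExp_ae_eq [CompleteSpace B] (hξ : IsIID μ ξ) {k : ℕ} (hk : k ≤ m)
    {f : (Fin m → S) → B} (hf : StronglyMeasurable f)
    (hfi : Integrable f (iidLaw (Fin m) (μ.map (ξ 0)))) :
    (fun ω => ∫ y, f (glueFirst (fun i : Fin k => ξ i ω) y) ∂(iidLaw (Fin m) (μ.map (ξ 0))))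
      =ᵐ[μ] μ[fun ω => f fun i => ξ i ω | firstSigma ξ k] := by
  have := Measure.isProbabilityMeasure_map (hξ.measurable 0).aemeasurable (μ := μ)
  have hmk := hξ.measurePreserving_fin k
  have hmm := hξ.measurePreserving_fin m
  have hmg := measurePreserving_glueFirst (P := μ.map (ξ 0)) k m
  have hG : StronglyMeasurable fun x : Fin k → S =>
      ∫ y, f (glueFirst x y) ∂(iidLaw (Fin m) (μ.map (ξ 0))) :=
    (hf.comp_measurable hmg.measurable).integral_prod_right'
  have hGi : Integrable (fun x : Fin k → S =>
      ∫ y, f (glueFirst x y) ∂(iidLaw (Fin m) (μ.map (ξ 0)))) (iidLaw (Fin k) (μ.map (ξ 0))) :=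
    ((hmg.integrable_comp hf.aestronglyMeasurable).2 hfi).integral_prod_left
  refine ae_eq_condExp_of_forall_setIntegral_eq (hξ.firstSigma_le k)
    ((hmm.integrable_comp hf.aestronglyMeasurable).2 hfi)
    (fun s _ _ => ((hmk.integrable_comp hG.aestronglyMeasurable).2 hGi).integrableOn) ?_
    (hG.comp_measurable (comap_measurable _)).aestronglyMeasurable
  rintro s ⟨A, hA, rfl⟩ -
  have h1 := setIntegral_map hA (hG.aestronglyMeasurable (μ := μ.map fun ω (i : Fin k) => ξ i ω))
    hmk.measurable.aemeasurable
  have h2 := setIntegral_map ((measurePreserving_castLE (P := μ.map (ξ 0)) hk).measurable hA)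
    (hf.aestronglyMeasurable (μ := μ.map fun ω (i : Fin m) => ξ i ω)) hmm.measurable.aemeasurable
  rw [hmk.map_eq] at h1
  rw [hmm.map_eq] at h2
  exact h1.symm.trans ((setIntegral_castLE hk hf hfi hA).symm.trans h2)

end conditional

/-! ### From kernels with a parameter back to the original statement. -/

section transfer

/-- A kernel seen as a kernel with a trivial parameter. -/
def trivialParam.{w} {S B : Type*} {m : ℕ} (h : (Fin m → S) → B)
    (w : (Fin m → S) × PUnit.{w + 1}) : B := h w.1

variable {B S Ω : Type*} [NormedAddCommGroup B] {m : ℕ} {h : (Fin m → S) → B} {p q : ℝ}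

lemma uStat_eq_uSum.{w} (h : (Fin m → S) → B) (ξ : ℕ → Ω → S) (n : ℕ) (ω : Ω)
    (t : PUnit.{w + 1}) : uStat h ξ n ω = uSum (trivialParam h) n (fun i => ξ i ω, t) := by
  refine Finset.sum_bij' (fun i _ => fun l => (i l : ℕ))
    (fun i hi => OrderEmbedding.ofStrictMono (fun l => ⟨i l, (mem_incTuples.1 hi).1 l⟩)
      fun a b hab => (mem_incTuples.1 hi).2 hab) ?_ ?_ ?_ ?_ ?_
  · exact fun i _ => mem_incTuples.2 ⟨fun l => (i l).2, fun a b hab => i.strictMono hab⟩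
  · exact fun _ _ => Finset.mem_univ _
  · intro i _; ext l; rfl
  · intro i _; rfl
  · intro i _; rfl

variable [MeasurableSpace S] [MeasurableSpace Ω] {μ : Measure Ω} [IsProbabilityMeasure μ]
  {ξ : ℕ → Ω → S}

lemma uPow_trivialParam.{w} (h : (Fin m → S) → B) (ξ : ℕ → Ω → S) (n : ℕ) (ω : Ω) :
    uPow p (Measure.dirac PUnit.unit.{w + 1}) (trivialParam h) n (fun i => ξ i ω)
      = ‖uStat h ξ n ω‖ₑ ^ p := by
  simp [uPow, npow, uStat_eq_uSum h ξ n ω PUnit.unit.{w + 1}]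

/-- By symmetry the moment given `J` has the law of the conditional moment given the first `J.card`
variables, which is one of the entries of the maximum defining `maxCondMoment`. -/
lemma partPow_trivialParam_le.{w} (hp : 0 < p) (hξ : IsIID μ ξ) (hh : StronglyMeasurable h)
    (hsym : IsSymmetricKernel h) (J : Finset (Fin m)) (s : ℝ) :
    tailInt p q (iidLaw (Fin m) (μ.map (ξ 0)))
      (partPow p (μ.map (ξ 0)) (Measure.dirac PUnit.unit.{w + 1}) (trivialParam h) J) s
      ≤ tailInt p q μ (fun ω => maxCondMoment μ ξ h p ω ^ p) s := by
  have := Measure.isProbabilityMeasure_map (hξ.measurable 0).aemeasurable (μ := μ)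
  set P := μ.map (ξ 0)
  obtain ⟨σ, hJ, hσ⟩ := exists_piecewise_eq_glueFirst (f := fun x => ‖h x‖ₑ ^ p)
    (fun σ x => by simp [hsym σ x]) J
  have hf : Measurable fun x => ‖h x‖ₑ ^ p := hh.enorm.pow_const p
  set Q : (Fin J.card → S) → ℝ≥0∞ := fun x => ∫⁻ y, ‖h (glueFirst x y)‖ₑ ^ p ∂(iidLaw (Fin m) P)
  have hQ : Measurable Q :=
    (hf.comp (measurePreserving_glueFirst (P := P) J.card m).measurable).lintegral_prod_right'
  have e : partPow p P (Measure.dirac PUnit.unit.{w + 1}) (trivialParam h) J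
      = fun x => Q fun i => x (σ (Fin.castLE hJ i)) := by
    ext x
    simp only [partPow, npow, trivialParam, lintegral_const, measure_univ, mul_one, hσ]
    have hg : Measurable fun y : Fin m → S =>
        ‖h (glueFirst (fun i => x (σ (Fin.castLE hJ i))) y)‖ₑ ^ p :=
      (hf.comp (measurePreserving_glueFirst (P := P) J.card m).measurable).comp
        measurable_prodMk_left
    exact (measurePreserving_comp_injective P σ.injective).lintegral_comp hg
  have hmp := measurePreserving_comp_injective P (f := fun i => σ (Fin.castLE hJ i))
    (σ.injective.comp (Fin.castLE_injective hJ))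
  rw [e, tailInt_measurePreserving hmp hQ,
    ← tailInt_measurePreserving (hξ.measurePreserving_fin J.card) hQ]
  refine tailInt_mono_ae ?_
  filter_upwards [hξ.condLExp_ae_eq hJ hf] with ω hω
  have h1 : (condLExp (firstSigma ξ J.card) μ (fun ω' => ‖kernelAt h ξ ω'‖ₑ ^ p) ω) ^ (1 / p)
      ≤ maxCondMoment μ ξ h p ω :=
    Finset.le_sup (f := fun k =>
      (condLExp (firstSigma ξ k) μ (fun ω' => ‖kernelAt h ξ ω'‖ₑ ^ p) ω) ^ (1 / p))
      (Finset.mem_range.2 (Nat.lt_succ_of_le hJ))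
  have h2 := ENNReal.rpow_le_rpow h1 hp.le
  rw [← ENNReal.rpow_mul, one_div_mul_cancel hp.ne', ENNReal.rpow_one] at h2
  exact hω.le.trans h2

variable [NormedSpace ℝ B]

lemma isDeg_trivialParam.{w} [CompleteSpace B] (hξ : IsIID μ ξ) (hh : StronglyMeasurable h)
    (hsym : IsSymmetricKernel h) {d : ℕ} (hd : IsDegenerateOfOrder μ ξ h d)
    (hi : Integrable h (iidLaw (Fin m) (μ.map (ξ 0)))) :
    IsDeg (μ.map (ξ 0)) (Measure.dirac PUnit.unit.{w + 1}) (trivialParam h) d := by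
  have := Measure.isProbabilityMeasure_map (hξ.measurable 0).aemeasurable (μ := μ)
  set P := μ.map (ξ 0)
  intro I hI
  obtain ⟨σ, hIm, hσ⟩ := exists_piecewise_eq_glueFirst hsym I
  set G : (Fin I.card → S) → B := fun x => ∫ y, h (glueFirst x y) ∂(iidLaw (Fin m) P)
  have hmg := measurePreserving_glueFirst (P := P) I.card m
  have hG : StronglyMeasurable G := (hh.comp_measurable hmg.measurable).integral_prod_right'
  have hmono : firstSigma ξ I.card ≤ firstSigma ξ (d - 1) := by
    have hle : I.card ≤ d - 1 := by omega
    have h1 : Measurable[firstSigma ξ (d - 1)] fun ω => fun i : Fin I.card => ξ i ω :=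
      (measurable_pi_iff.2 fun i : Fin I.card => measurable_pi_apply (Fin.castLE hle i)).comp
        (comap_measurable fun ω => fun i : Fin (d - 1) => ξ i ω)
    exact h1.comap_le
  -- The tower property: vanishing given `d - 1` variables implies vanishing given fewer.
  have h0 : μ[kernelAt h ξ | firstSigma ξ I.card] =ᵐ[μ] 0 := by
    have h1 := condExp_condExp_of_le (μ := μ) (f := kernelAt h ξ) hmono (hξ.firstSigma_le (d - 1))
    have h2 := condExp_congr_ae (m := firstSigma ξ I.card) hd.condExp_eq_zero
    rw [condExp_zero] at h2
    exact h1.symm.trans h2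
  have hG0 : ∀ᵐ x ∂(iidLaw (Fin I.card) P), G x = 0 := by
    have hmk := hξ.measurePreserving_fin I.card
    rw [← hmk.map_eq, ae_map_iff hmk.measurable.aemeasurable
      (hG.measurableSet_eq_fun stronglyMeasurable_const)]
    exact (hξ.condExp_ae_eq hIm hh hi).trans h0
  have hmp := measurePreserving_comp_injective P (f := fun i => σ (Fin.castLE hIm i))
    (σ.injective.comp (Fin.castLE_injective hIm))
  have h3 := (measurePreserving_fst (μ := iidLaw (Fin m) P)
    (ν := Measure.dirac PUnit.unit.{w + 1})).quasiMeasurePreserving.ae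
      (hmp.quasiMeasurePreserving.ae hG0)
  filter_upwards [h3] with z hz
  simp only [trivialParam, hσ]
  rw [← hz]
  have hms := measurePreserving_comp_injective P σ.injective
  have e := integral_map (μ := iidLaw (Fin m) P) hms.measurable.aemeasurable
    (f := fun y => h (glueFirst (fun i => z.1 (σ (Fin.castLE hIm i))) y))
    ((hh.comp_measurable hmg.measurable).comp_measurable
      measurable_prodMk_left).aestronglyMeasurable
  rw [hms.map_eq] at e
  exact e.symm

lemma measure_maxUStat_le.{w} (hp : 0 < p) (hq : 0 < q) (hξ : IsIID μ ξ)
    (hh : StronglyMeasurable h) (N : ℕ) {s : ℝ} (hs : 0 ≤ s) :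
    μ {ω | s < (maxUStat h ξ N ω : ℝ)} ≤ ENNReal.ofReal q *
      tailInt p q (iidLaw ℕ (μ.map (ξ 0))) (fun x => (Finset.range (N + 1)).sup fun n =>
        uPow p (Measure.dirac PUnit.unit.{w + 1}) (trivialParam h) n x) (s ^ p) := by
  have hm : StronglyMeasurable
      (trivialParam h : (Fin m → S) × PUnit.{w + 1} → B) := hh.comp_measurable measurable_fst
  rw [← tailInt_measurePreserving hξ.measurePreserving
    (measurable_finset_sup _ fun n => measurable_uPow hm n)]
  refine le_trans (measure_mono fun ω hω => ?_) (measure_le_tailInt hp hq (by positivity) _)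
  have hω' : s < (maxUStat h ξ N ω : ℝ) := hω
  obtain ⟨n, hn, hlt⟩ : ∃ n ∈ Finset.Icc m N, s.toNNReal < ‖uStat h ξ n ω‖₊ := by
    have h1 : s.toNNReal < (Finset.Icc m N).sup fun n => ‖uStat h ξ n ω‖₊ :=
      (Real.toNNReal_lt_iff_lt_coe hs).2 hω'
    exact Finset.lt_sup_iff.1 h1
  rw [Set.mem_ofPred_eq, Finset.lt_sup_iff]
  refine ⟨n, Finset.mem_range.2 ?_, ?_⟩
  · have := (Finset.mem_Icc.1 hn).2; omega
  · rw [uPow_trivialParam, ← ENNReal.ofReal_rpow_of_nonneg hs hp.le]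
    exact ENNReal.rpow_lt_rpow (ENNReal.coe_lt_coe.2 hlt) hp

lemma tailInt_maxCondMoment_eq (hp : 0 < p) {s : ℝ} (hs : 0 ≤ s) :
    tailInt p q μ (fun ω => maxCondMoment μ ξ h p ω ^ p) (s ^ p)
      = ∫⁻ u in Set.Ioc (0 : ℝ) 1, ENNReal.ofReal (u ^ (q - 1)) *
          μ {ω | ENNReal.ofReal (s * u) < maxCondMoment μ ξ h p ω} := by
  refine weightInt_congr fun u hu _ => ?_
  congr 1
  ext ω
  simp only [Set.mem_ofPred_eq]
  rw [← Real.mul_rpow hs hu.le, ← ENNReal.ofReal_rpow_of_nonneg (by positivity) hp.le,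
    ENNReal.rpow_lt_rpow_iff hp]

end transfer

theorem mainTheorem3 {B : Type*} [NormedAddCommGroup B] [NormedSpace ℝ B] [CompleteSpace B]
    [TopologicalSpace.SeparableSpace B] [MeasurableSpace B] [BorelSpace B]
    (m : ℕ) (p q : ℝ) (hp : 1 < p) (hq : 0 < q) :
    ∃ K : ℝ, 0 < K ∧ ∀ r : ℝ, p ≤ r → r ≤ 2 → IsRSmooth r B →
      ∀ (Ω S : Type*) [MeasurableSpace Ω] [MeasurableSpace S]
        (μ : Measure Ω) [IsProbabilityMeasure μ] (ξ : ℕ → Ω → S)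
        (h : (Fin m → S) → B) (d : ℕ),
        IsIID μ ξ → Measurable h → IsSymmetricKernel h → IsDegenerateOfOrder μ ξ h d →
        ∀ (N : ℕ) (t : ℝ), 0 < t →
          μ {ω | t * (N : ℝ) ^ ((m : ℝ) - d + d / p) < (maxUStat h ξ N ω : ℝ)} ≤
            ENNReal.ofReal K * ∑ j ∈ Finset.range (m + 1), (N : ℝ≥0∞) ^ j *
              ∫⁻ u in Set.Ioc (0 : ℝ) 1, ENNReal.ofReal (u ^ (q - 1)) *
                μ {ω | ENNReal.ofReal
                      (t * (N : ℝ) ^ (((max d j : ℕ) - (d : ℝ)) * ((p - 1) / p) + j / p) * u)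
                    < maxCondMoment μ ξ h p ω} := by
  -- The constant has to be chosen before `r`, so it is built from one admissible exponent; if there
  -- is none, the claim is vacuous.
  by_cases hsm : ∃ r : ℝ, p ≤ r ∧ r ≤ 2 ∧ IsRSmooth r B
  swap
  · exact ⟨1, one_pos, fun r h1 h2 h3 => absurd ⟨r, h1, h2, h3⟩ hsm⟩
  obtain ⟨r₀, hpr₀, hr₀, hsm⟩ := hsm
  have hp0 : 0 < p := by linarith
  obtain ⟨ν, C₀, hC₀, hν⟩ := hsm.exists_isPowerSmooth hp hpr₀ hr₀
  obtain ⟨C, hC, hB⟩ := hν.exists_hasMartingaleType hp.le hC₀.le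
  obtain ⟨K, hK, hKb⟩ := exists_hasUTailBound hC hB hp (hpr₀.trans hr₀) hq m
  refine ⟨(ENNReal.ofReal q * (K * 2 ^ m)).toReal + 1, by positivity, ?_⟩
  intro r _ _ _ Ω S _ _ μ _ ξ h d hξ hh hsym hd N t ht
  have := Measure.isProbabilityMeasure_map (hξ.measurable 0).aemeasurable (μ := μ)
  have hhs : StronglyMeasurable h := hh.stronglyMeasurable
  have hi : Integrable h (iidLaw (Fin m) (μ.map (ξ 0))) :=
    ((hξ.measurePreserving_fin m).integrable_comp hhs.aestronglyMeasurable).1 hd.integrable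
  -- For `N = 0` the maximum runs over an empty range, because `1 ≤ d ≤ m`, and the event is empty.
  rcases Nat.eq_zero_or_pos N with rfl | hN
  · have hm : 1 ≤ m := hd.one_le.trans hd.le_order
    have : {ω | t * ((0 : ℕ) : ℝ) ^ ((m : ℝ) - d + d / p) < (maxUStat h ξ 0 ω : ℝ)} = ∅ := by
      ext ω
      have h1 : (maxUStat h ξ 0 ω : ℝ) = 0 := by
        simp [maxUStat, Finset.Icc_eq_empty (not_le.2 (Nat.lt_of_lt_of_le Nat.zero_lt_one hm))]
      simp only [Set.mem_ofPred_eq, Set.mem_empty_iff_false, iff_false, not_lt, h1]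
      positivity
    rw [this, measure_empty]
    exact zero_le
  have hN0 : (0 : ℝ) < N := by exact_mod_cast hN
  have hpow : ∀ a : ℝ, (t * (N : ℝ) ^ a) ^ p = t ^ p * (N : ℝ) ^ (p * a) := fun a => by
    rw [Real.mul_rpow ht.le (by positivity), ← Real.rpow_mul hN0.le, mul_comm a]
  -- The parameter starts as a single point with a Dirac law; the threshold is `t ^ p` since the
  -- induction works with `p`-th powers.
  have hbound := hKb S PUnit (μ.map (ξ 0)) (Measure.dirac PUnit.unit) (trivialParam h)
    (hhs.comp_measurable measurable_fst) (measurePreserving_fst.integrable_comp hi.1 |>.2 hi) d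
    (isDeg_trivialParam hξ hhs hsym hd hi) N hN (t ^ p) (by positivity)
  have hterm : ∀ j : ℕ, sumTail p q (μ.map (ξ 0)) (Measure.dirac PUnit.unit) (trivialParam h)
      (t ^ p * (N : ℝ) ^ tailExp p d j) ≤ 2 ^ m *
      ∫⁻ u in Set.Ioc (0 : ℝ) 1, ENNReal.ofReal (u ^ (q - 1)) *
        μ {ω | ENNReal.ofReal
          (t * (N : ℝ) ^ (((max d j : ℕ) - (d : ℝ)) * ((p - 1) / p) + j / p) * u)
            < maxCondMoment μ ξ h p ω} := by
    intro j
    rw [← tailInt_maxCondMoment_eq hp0 (by positivity), hpow,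
      show p * (((max d j : ℕ) - (d : ℝ)) * ((p - 1) / p) + j / p) = tailExp p d j by
        unfold tailExp; field_simp]
    exact sum_finset_le_of_forall_le fun J => partPow_trivialParam_le hp0 hξ hhs hsym J _
  calc _ ≤ _ := measure_maxUStat_le hp0 hq hξ hhs N (by positivity)
    _ ≤ ENNReal.ofReal q * (K * ∑ j ∈ Finset.range (m + 1), (N : ℝ≥0∞) ^ j * (2 ^ m *
        ∫⁻ u in Set.Ioc (0 : ℝ) 1, ENNReal.ofReal (u ^ (q - 1)) *
          μ {ω | ENNReal.ofReal
            (t * (N : ℝ) ^ (((max d j : ℕ) - (d : ℝ)) * ((p - 1) / p) + j / p) * u)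
              < maxCondMoment μ ξ h p ω})) := by
        rw [hpow, show p * ((m : ℝ) - d + d / p) = p * (m - d) + d by field_simp]
        gcongr
        refine hbound.trans ?_
        gcongr with j
        exact hterm j
    _ ≤ _ := by
        simp_rw [mul_left_comm _ (2 ^ m : ℝ≥0∞)]
        rw [← Finset.mul_sum, ← mul_assoc, ← mul_assoc, mul_assoc (ENNReal.ofReal q)]
        gcongr
        rw [ENNReal.le_ofReal_iff_toReal_le (by finiteness) (by positivity)]
        linarith
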